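/- Let $n\ge 1$ and let $(M,g)$ be an oriented smooth Riemannian $4n$-manifold. Write $N=4n$ and let $W$ be the Weyl tensor, defined by $\mathrm{Rm}=W+\frac{1}{N-2}\mathrm{KN}(\mathring{\mathrm{Ric}},g)+\frac{\mathrm{scal}}{2N(N-1)}\mathrm{KN}(g,g)$, where $\mathrm{Rm}(u,v,u,v)$ is the sectional curvature of an orthonormal pair $u,v$, $\mathring{\mathrm{Ric}}=\mathrm{Ric}-\frac{\mathrm{scal}}{N}g$, and $\mathrm{KN}(h,k)(u,v,a,b)=h(u,a)k(v,b)+h(v,b)k(u,a)-h(u,b)k(v,a)-h(v,a)k(u,b)$ is the Kulkarni–Nomizu product. On $\Lambda^p=\Lambda^p(T_qM)$ use the inner product $\langle u_1\wedge\dots\wedge u_p,v_1\wedge\dots\wedge v_p\rangle=\det[g(u_i,v_j)]$. With $p=2n$, the $2n$-th Weyl curvature operator is the endomorphism $\hat W_{2n}$ of $\Lambda^{2n}$ with $$\langle\hat W_{2n}(u_1\wedge\dots\wedge u_p),v_1\wedge\dots\wedge v_p\rangle=\frac{1}{2^{p/2}p!}\sum_{\sigma,\tau\in S_p}\varepsilon(\sigma)\varepsilon(\tau)\prod_{i=1}^{p/2}W(u_{\sigma(2i-1)},u_{\sigma(2i)},v_{\tau(2i-1)},v_{\tau(2i)}),$$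 and the Hodge star $*\colon\Lambda^{2n}\to\Lambda^{2n}$ is defined by $\xi\wedge *\eta=\langle\xi,\eta\rangle\,dV$, where $dV=e_1\wedge\dots\wedge e_{4n}$ for any oriented orthonormal basis of $T_qM$. A Hodge basis of $\Lambda^{2n}$ is an orthonormal basis in which $*=\begin{bmatrix}O&I\\I&O\end{bmatrix}$, with blocks of size $m=\frac12\binom{4n}{2n}$. Then, at every point $q\in M$: 1. The condition $*\hat W_{2n}=\hat W_{2n}*$ is a conformal invariant: it holds at $q$ for $g$ if and only if it holds at $q$ for $e^{2f}g$, for every smooth $f\colon M\to\mathbb R$. 2. For every oriented orthonormal basis $\{e_i\}$ of $T_qM$ there is a Hodge basis of $\Lambda^{2n}$ all of whose elements are of the form $e_{i_1}\wedge\dots\wedge e_{i_{2n}}$. In every Hodge basis, $*\hat W_{2n}=\hat W_{2n}*$ holds if and only if $\hat W_{2n}=\begin{bmatrix}A&B\\B&A\end{bmatrix}$ for some $m\times m$ matrices $A,B$. 3. Let $\epsilon\in\{1,-1\}$. The condition that $\hat W_{2n}=\begin{bmatrix}A&B\\B&A\end{bmatrix}$ with $B=\epsilon A$ in some Hodge basis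 arising from an oriented orthonormal basis of $T_qM$ as in 2 is equivalent to the same condition in every Hodge basis, and is a conformal invariant in the sense of 1. It is equivalent to $*\hat W_{2n}=\hat W_{2n}*$ together with $\hat W_{2n}^{-\epsilon}=0$, where $\hat W_{2n}^{\pm}=P_\pm\hat W_{2n}P_\pm$ and $P_\pm=\frac12(1\pm *)$ is the projection onto the $\pm1$-eigenspace of $*$. 4. These conditions generalize self-duality and anti-self-duality. If $n=1$, then $\hat W_2$ is the usual Weyl curvature operator $\hat W$, i.e. $\langle\hat W_2(u_1\wedge u_2),v_1\wedge v_2\rangle=W(u_1,u_2,v_1,v_2)$, the condition $*\hat W_2=\hat W_2*$ always holds, $B=A$ is equivalent to $W^-=0$ (self-dual), and $B=-A$ is equivalent to $W^+=0$ (anti-self-dual), where $W^\pm=P_\pm\hat W P_\pm$. -/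

import Mathlib

set_option maxSynthPendingDepth 3

open scoped Manifold ContDiff
open Module

noncomputable section

namespace HigherWeyl

section Algebra

variable {V : Type*} [AddCommGroup V] [Module ℝ V]

/-- `B` is a (positive definite) inner product on `V`. -/
structure IsInner (B : LinearMap.BilinForm ℝ V) : Prop where
  symm : ∀ u v, B u v = B v u
  pos : ∀ u, u ≠ 0 → 0 < B u u

/-- The bilinear form induced by `B` on `Λ^p V`; by `extInner_ιMulti` it is
`⟨u₁ ∧ ⋯ ∧ u_p, v₁ ∧ ⋯ ∧ v_p⟩ = det [B (u i) (v j)]`. -/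
def extInner (B : LinearMap.BilinForm ℝ V) (p : ℕ) : LinearMap.BilinForm ℝ (⋀[ℝ]^p V) :=
  exteriorPower.pairingDual ℝ V p ∘ₗ exteriorPower.map p B

theorem extInner_ιMulti (B : LinearMap.BilinForm ℝ V) (p : ℕ) (u v : Fin p → V) :
    extInner B p (exteriorPower.ιMulti ℝ p u) (exteriorPower.ιMulti ℝ p v) =
      (Matrix.of fun i j => B (u i) (v j)).det := by
  rw [← Matrix.det_transpose (Matrix.of fun i j => B (u i) (v j))]
  simp only [extInner, LinearMap.comp_apply, exteriorPower.map_apply_ιMulti,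
    exteriorPower.pairingDual_ιMulti_ιMulti]
  rfl

/-- `e` is a `B`-orthonormal basis which is positively oriented for `o`. -/
def IsPosONB {N : ℕ} (B : LinearMap.BilinForm ℝ V) (o : Orientation ℝ V (Fin N))
    (e : Basis (Fin N) ℝ V) : Prop :=
  (∀ i j, B (e i) (e j) = if i = j then 1 else 0) ∧ e.orientation = o

/-- `S : Λ^p V → Λ^q V` is the Hodge star: `ξ ∧ S η = ⟨ξ, η⟩ dV` (the wedge product being the
product of the exterior algebra), where `dV = e₁ ∧ ⋯ ∧ e_N` for any oriented orthonormal basis. -/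
def IsHodgeStar {N p q : ℕ} (B : LinearMap.BilinForm ℝ V) (o : Orientation ℝ V (Fin N))
    (S : ⋀[ℝ]^p V →ₗ[ℝ] ⋀[ℝ]^q V) : Prop :=
  ∀ e : Basis (Fin N) ℝ V, IsPosONB B o e → ∀ ξ η : ⋀[ℝ]^p V,
    (ξ : ExteriorAlgebra ℝ V) * (S η : ExteriorAlgebra ℝ V) =
      extInner B p ξ η • ExteriorAlgebra.ιMulti ℝ N e

theorem exists_isPosONB {N : ℕ} (hN : 0 < N) (hV : finrank ℝ V = N)
    {B : LinearMap.BilinForm ℝ V} (hB : IsInner B) (o : Orientation ℝ V (Fin N)) :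
    ∃ e : Basis (Fin N) ℝ V, IsPosONB B o e := by
  have : FiniteDimensional ℝ V := FiniteDimensional.of_finrank_pos (by omega)
  have : Nonempty (Fin N) := ⟨⟨0, hN⟩⟩
  have hsymm : B.IsSymm := ⟨fun u v => by simpa using hB.symm u v⟩
  obtain ⟨v, hv⟩ := LinearMap.BilinForm.exists_orthogonal_basis
    (B := B) (LinearMap.BilinForm.isSymm_iff.1 hsymm)
  let v' := v.reindex (finCongr hV)
  have hv' : ∀ i j, i ≠ j → B (v' i) (v' j) = 0 := by
    intro i j hij
    simpa [v'] using hv (i := (finCongr hV).symm i) (j := (finCongr hV).symm j) (by simpa using hij)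
  have hpos : ∀ i, 0 < B (v' i) (v' i) := fun i => hB.pos _ (v'.ne_zero i)
  let w : Fin N → ℝˣ := fun i => Units.mk0 ((Real.sqrt (B (v' i) (v' i)))⁻¹)
    (inv_ne_zero (Real.sqrt_pos.2 (hpos i)).ne')
  let a := v'.unitsSMul w
  have ha : ∀ i j, B (a i) (a j) = if i = j then 1 else 0 := by
    intro i j
    simp only [a, Basis.unitsSMul_apply, Units.smul_def, map_smul, LinearMap.smul_apply, smul_eq_mul]
    split_ifs with h
    · subst h
      have h1 := (Real.sqrt_pos.2 (hpos i)).ne'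
      have h2 := Real.mul_self_sqrt (hpos i).le
      simp only [w, Units.val_mk0]
      field_simp
      nlinarith
    · simp [hv' i j h]
  refine ⟨a.adjustToOrientation o, ?_, a.orientation_adjustToOrientation o⟩
  intro i j
  have key := ha i j
  rcases a.adjustToOrientation_apply_eq_or_eq_neg o i with h1 | h1 <;>
  rcases a.adjustToOrientation_apply_eq_or_eq_neg o j with h2 | h2
  · simpa [h1, h2] using key
  · by_cases hij : i = j
    · subst hij
      rw [h1] at h2
      rw [h1]; exact key
    · simp [h1, h2, key, hij]
  · by_cases hij : i = j
    · subst hij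
      rw [h2] at h1
      rw [h2]; exact key
    · simp [h1, h2, key, hij]
  · simpa [h1, h2] using key

theorem IsPosONB.ιMulti_eq {N : ℕ} {B : LinearMap.BilinForm ℝ V} {o : Orientation ℝ V (Fin N)}
    {e e' : Basis (Fin N) ℝ V} (he : IsPosONB B o e) (he' : IsPosONB B o e') :
    ExteriorAlgebra.ιMulti ℝ N e' = ExteriorAlgebra.ιMulti ℝ N e := by
  have hpos : 0 < e.det e' := (Basis.orientation_eq_iff_det_pos e e').1 (he.2.trans he'.2.symm)
  have hP : (e.toMatrix e').transpose * e.toMatrix e' = 1 := by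
    ext i j
    have h := he'.1 i j
    rw [← e.sum_toMatrix_smul_self e' i, ← e.sum_toMatrix_smul_self e' j] at h
    simp only [map_sum, map_smul, LinearMap.sum_apply, LinearMap.smul_apply, smul_eq_mul,
      he.1] at h
    simp [Matrix.mul_apply, Matrix.one_apply] at h ⊢
    simpa [mul_comm] using h
  have hsq : e.det e' * e.det e' = 1 := by
    have := congrArg Matrix.det hP
    simpa [Basis.det_apply] using this
  have h1 : e.det e' = 1 := by nlinarith
  have h2 : ExteriorAlgebra.ιMulti ℝ N (M := V) =
      (LinearMap.toSpanSingleton ℝ _ (ExteriorAlgebra.ιMulti ℝ N e)).compAlternatingMap e.det :=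
    Basis.ext_alternating e fun v hv => by
      let σ : Equiv.Perm (Fin N) := Equiv.ofBijective v (Finite.injective_iff_bijective.1 hv)
      have e1 : (fun i => e (v i)) = e ∘ σ := rfl
      rw [e1, AlternatingMap.map_perm, AlternatingMap.map_perm]
      simp [e.det_self]
  rw [h2]
  simp [h1, e.det_self]

theorem extInner_basis {N : ℕ} {B : LinearMap.BilinForm ℝ V}
    {e : Basis (Fin N) ℝ V} (he : ∀ i j, B (e i) (e j) = if i = j then 1 else 0) (p : ℕ)
    (I : Set.powersetCard (Fin N) p) (x : ⋀[ℝ]^p V) :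
    extInner B p (e.exteriorPower p I) x = (e.exteriorPower p).repr x I := by
  have hc : ∀ i, B (e i) = e.coord i := fun i => e.ext fun j => by
    rw [he]; simp [Finsupp.single_apply, eq_comm]
  have hc' : (B : V →ₗ[ℝ] Dual ℝ V) ∘ e = e.coord := funext hc
  rw [exteriorPower.basis_repr_apply, exteriorPower.ιMultiDual, extInner, LinearMap.comp_apply,
    exteriorPower.basis_apply, exteriorPower.map_apply_ιMulti_family, hc']

theorem existsUnique_isHodgeStar {N p q : ℕ} (hN : 0 < N) (hV : finrank ℝ V = N) (hpq : p + q = N)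
    {B : LinearMap.BilinForm ℝ V} (hB : IsInner B) (o : Orientation ℝ V (Fin N)) :
    ∃! S : ⋀[ℝ]^p V →ₗ[ℝ] ⋀[ℝ]^q V, IsHodgeStar B o S := by
  obtain ⟨e, he⟩ := exists_isPosONB hN hV hB o
  have hc : q + p = Fintype.card (Fin N) := by simp; omega
  let C := Set.powersetCard.compl (α := Fin N) (n := p) (m := q) hc
  have hd : ∀ J : Set.powersetCard (Fin N) p, Disjoint J.val (C J).val := fun J => disjoint_compl_right
  let ε : Set.powersetCard (Fin N) p → ℤˣ :=
    fun J => (Set.powersetCard.permOfDisjoint (hd J)).sign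
  have hmul : ∀ I J : Set.powersetCard (Fin N) p,
      (e.exteriorPower p I : ExteriorAlgebra ℝ V) * (e.exteriorPower q (C J) : ExteriorAlgebra ℝ V)
        = if I = J then ε J • ExteriorAlgebra.ιMulti ℝ N e else 0 := by
    intro I J
    rw [← ExteriorAlgebra.basis_eq_coe_basis, ← ExteriorAlgebra.basis_eq_coe_basis]
    split_ifs with h
    · subst h
      rw [ExteriorAlgebra.basis_mul_of_disjoint e I (C I) (hd I)]
      congr 1
      subst hpq
      rw [ExteriorAlgebra.basis_apply_powersetCard]
      rw [ExteriorAlgebra.ιMulti_family]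
      congr 1
      have : ∀ f : Fin (p + q) ↪o Fin (p + q), ⇑e ∘ f = e := by
        intro f
        have : f = (OrderIso.refl _).toOrderEmbedding := by
          have hu : ∀ s : Set.powersetCard (Fin (p + q)) (p + q), s.val = Finset.univ :=
            fun s => Finset.eq_univ_of_card _ (by simp)
          apply Set.powersetCard.ofFinEmbEquiv.injective
          exact Subtype.ext ((hu _).trans (hu _).symm)
        subst this; rfl
      exact this _
    · apply ExteriorAlgebra.basis_mul_of_not_disjoint
      intro hdis
      apply h
      apply Set.powersetCard.eq_iff_subset.2
      have : Disjoint I.val (J.val)ᶜ := hdis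
      simpa using Finset.subset_compl_iff_disjoint_right.2 this
  let S : ⋀[ℝ]^p V →ₗ[ℝ] ⋀[ℝ]^q V :=
    (e.exteriorPower p).constr ℝ fun J => ((ε J : ℤ) : ℝ) • e.exteriorPower q (C J)
  have hS : ∀ J, S (e.exteriorPower p J) = ((ε J : ℤ) : ℝ) • e.exteriorPower q (C J) := fun J => by
    simp only [S, Basis.constr_basis]
  have hεε : ∀ J, ((ε J : ℤ) : ℝ) * ((ε J : ℤ) : ℝ) = 1 := fun J => by
    rcases Int.units_eq_one_or (ε J) with h | h <;> simp [h]
  refine ⟨S, ?_, ?_⟩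
  · intro e' he' ξ η
    rw [he.ιMulti_eq he']
    let L : ⋀[ℝ]^p V →ₗ[ℝ] ⋀[ℝ]^p V →ₗ[ℝ] ExteriorAlgebra ℝ V :=
      (LinearMap.mul ℝ (ExteriorAlgebra ℝ V)).compl₁₂ (Submodule.subtype _)
        ((Submodule.subtype _) ∘ₗ S)
    let R : ⋀[ℝ]^p V →ₗ[ℝ] ⋀[ℝ]^p V →ₗ[ℝ] ExteriorAlgebra ℝ V :=
      (extInner B p).compr₂ (LinearMap.toSpanSingleton ℝ _ (ExteriorAlgebra.ιMulti ℝ N e))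
    have hLR : L = R := by
      refine (e.exteriorPower p).ext fun I => (e.exteriorPower p).ext fun J => ?_
      have h1 : L (e.exteriorPower p I) (e.exteriorPower p J) =
        (e.exteriorPower p I : ExteriorAlgebra ℝ V) *
          (S (e.exteriorPower p J) : ExteriorAlgebra ℝ V) := rfl
      have h2 : R (e.exteriorPower p I) (e.exteriorPower p J) =
        extInner B p (e.exteriorPower p I) (e.exteriorPower p J) •
          ExteriorAlgebra.ιMulti ℝ N e := rfl
      rw [h1, h2, hS, extInner_basis he.1, Basis.repr_self, Finsupp.single_apply, Submodule.coe_smul,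
        mul_smul_comm, hmul]
      by_cases h : I = J
      · subst h
        simp only [if_true, Units.smul_def, ← Int.cast_smul_eq_zsmul ℝ, smul_smul, hεε]
      · rw [if_neg h, if_neg (fun h' => h h'.symm), smul_zero, zero_smul]
    exact LinearMap.congr_fun₂ hLR ξ η
  · intro S' hS'
    refine (e.exteriorPower p).ext fun J => ?_
    rw [hS]
    refine (e.exteriorPower q).repr.injective (Finsupp.ext fun K => ?_)
    obtain ⟨I, rfl⟩ := C.surjective K
    have h := hS' e he (e.exteriorPower p I) (e.exteriorPower p J)
    rw [extInner_basis he.1, Basis.repr_self, Finsupp.single_apply,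
      ← (e.exteriorPower q).sum_repr (S' _), Submodule.coe_sum, Finset.mul_sum,
      ← C.sum_comp] at h
    simp only [Submodule.coe_smul, mul_smul_comm, hmul, smul_ite, smul_zero,
      Finset.sum_ite_eq, Finset.mem_univ, if_true] at h
    have hne : ExteriorAlgebra.ιMulti ℝ N e ≠ 0 := by
      intro h0
      have h1 : exteriorPower.ιMulti ℝ N e = 0 := Subtype.ext h0
      have h2 := exteriorPower.alternatingMapLinearEquiv_apply_ιMulti e.det e
      rw [h1, map_zero, e.det_self] at h2
      exact zero_ne_one h2
    rw [Units.smul_def, ← Int.cast_smul_eq_zsmul ℝ, smul_smul] at h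
    have h' := smul_left_injective ℝ hne h
    rw [map_smul, Basis.repr_self, Finsupp.smul_single, Finsupp.single_apply, smul_eq_mul, mul_one]
    have : ((e.exteriorPower q).repr (S' (e.exteriorPower p J)) (C I)) =
        ((ε I : ℤ) : ℝ) * if J = I then 1 else 0 := by
      rw [← h', mul_comm, mul_assoc, hεε, mul_one]
    rw [this]
    by_cases hJI : J = I
    · subst hJI; simp
    · rw [if_neg hJI, if_neg (fun h => hJI (C.injective h)), mul_zero]

/-- `W` is linear in each of its four arguments. -/
structure IsFourLinear (W : V → V → V → V → ℝ) : Prop where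
  fst : ∀ v a b, IsLinearMap ℝ fun u => W u v a b
  snd : ∀ u a b, IsLinearMap ℝ fun v => W u v a b
  thd : ∀ u v b, IsLinearMap ℝ fun a => W u v a b
  fth : ∀ u v a, IsLinearMap ℝ fun b => W u v a b

/-- The position of the first entry of the `i`-th pair among `2k` letters. -/
def pairL {k : ℕ} (i : Fin k) : Fin (2 * k) := ⟨2 * i, by omega⟩

/-- The position of the second entry of the `i`-th pair among `2k` letters. -/
def pairR {k : ℕ} (i : Fin k) : Fin (2 * k) := ⟨2 * i + 1, by omega⟩

/-- With `p = 2k`, the `2p`-tensor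
`W_p(u, v) = 1 / (2^{p/2} p!) ∑_{σ, τ ∈ S_p} ε(σ) ε(τ)
  W(u_{σ(1)}, u_{σ(2)}, v_{τ(1)}, v_{τ(2)}) ⋯ W(u_{σ(p-1)}, u_{σ(p)}, v_{τ(p-1)}, v_{τ(p)})`. -/
def powTensor (W : V → V → V → V → ℝ) (k : ℕ) (u v : Fin (2 * k) → V) : ℝ :=
  (2 ^ k * (Nat.factorial (2 * k) : ℝ))⁻¹ *
    ∑ σ : Equiv.Perm (Fin (2 * k)), ∑ τ : Equiv.Perm (Fin (2 * k)),
      ((Equiv.Perm.sign σ : ℤ) : ℝ) * ((Equiv.Perm.sign τ : ℤ) : ℝ) *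
        ∏ i : Fin k, W (u (σ (pairL i))) (u (σ (pairR i))) (v (τ (pairL i))) (v (τ (pairR i)))

/-- The product of `k` bilinear forms in consecutive pairs of arguments is multilinear. -/
def pairProd {k : ℕ} (F : Fin k → V → V → ℝ) (h1 : ∀ i v, IsLinearMap ℝ fun u => F i u v)
    (h2 : ∀ i u, IsLinearMap ℝ fun v => F i u v) :
    MultilinearMap ℝ (fun _ : Fin (2 * k) => V) ℝ := by
  classical
  have key : ∀ (u : Fin (2 * k) → V) (j : Fin (2 * k)), IsLinearMap ℝ fun x : V =>
      ∏ i : Fin k, F i (Function.update u j x (pairL i)) (Function.update u j x (pairR i)) := by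
    intro u j
    obtain ⟨i₀, hi₀⟩ : ∃ i₀ : Fin k, j = pairL i₀ ∨ j = pairR i₀ :=
      ⟨⟨j / 2, by omega⟩, by simp only [pairL, pairR, Fin.ext_iff]; omega⟩
    have hrest : ∀ x : V, ∏ i : Fin k, F i (Function.update u j x (pairL i))
        (Function.update u j x (pairR i)) = F i₀ (Function.update u j x (pairL i₀))
          (Function.update u j x (pairR i₀)) *
            ∏ i ∈ Finset.univ.erase i₀, F i (u (pairL i)) (u (pairR i)) := by
      intro x
      rw [← Finset.mul_prod_erase Finset.univ _ (Finset.mem_univ i₀)]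
      congr 1
      refine Finset.prod_congr rfl fun i hi => ?_
      have hne : (i : ℕ) ≠ i₀ := fun h => (Finset.mem_erase.1 hi).1 (Fin.ext h)
      rw [Function.update_of_ne, Function.update_of_ne]
      · rintro rfl; simp only [pairL, pairR, Fin.ext_iff] at hi₀; omega
      · rintro rfl; simp only [pairL, pairR, Fin.ext_iff] at hi₀; omega
    simp only [hrest]
    have hLR : pairL i₀ ≠ pairR i₀ := by simp [pairL, pairR, Fin.ext_iff]
    rcases hi₀ with rfl | rfl
    · simp only [Function.update_self, Function.update_of_ne hLR.symm]
      exact ⟨fun x y => by rw [(h1 i₀ _).map_add]; ring,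
        fun c x => by rw [(h1 i₀ _).map_smul]; simp [mul_assoc]⟩
    · simp only [Function.update_self, Function.update_of_ne hLR]
      exact ⟨fun x y => by rw [(h2 i₀ _).map_add]; ring,
        fun c x => by rw [(h2 i₀ _).map_smul]; simp [mul_assoc]⟩
  exact MultilinearMap.mk' (fun u => ∏ i : Fin k, F i (u (pairL i)) (u (pairR i)))
    (fun u j x y => (key u j).map_add x y) (fun u j c x => (key u j).map_smul c x)

theorem alternatingMap_sum_apply {ι κ : Type*} (s : Finset κ) (A : κ → V [⋀^ι]→ₗ[ℝ] ℝ)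
    (u : ι → V) : (∑ i ∈ s, A i) u = ∑ i ∈ s, A i u := by
  classical
  induction s using Finset.induction_on with
  | empty => simp
  | insert a s ha ih => rw [Finset.sum_insert ha, Finset.sum_insert ha, AlternatingMap.add_apply, ih]

/-- `powTensor W k` as an alternating map in its first group of arguments. -/
theorem exists_alternating_left {W : V → V → V → V → ℝ} (hW : IsFourLinear W) (k : ℕ)
    (v : Fin (2 * k) → V) :
    ∃ A : V [⋀^Fin (2 * k)]→ₗ[ℝ] ℝ, ∀ u, A u = powTensor W k u v := by
  refine ⟨(2 ^ k * (Nat.factorial (2 * k) : ℝ))⁻¹ • ∑ τ : Equiv.Perm (Fin (2 * k)),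
    ((Equiv.Perm.sign τ : ℤ) : ℝ) • MultilinearMap.alternatization
      (pairProd (fun i a b => W a b (v (τ (pairL i))) (v (τ (pairR i))))
        (fun i b => hW.fst _ _ _) (fun i b => hW.snd _ _ _)), fun u => ?_⟩
  simp only [AlternatingMap.smul_apply, alternatingMap_sum_apply,
    MultilinearMap.alternatization_apply, MultilinearMap.domDomCongr_apply, powTensor, smul_eq_mul]
  rw [Finset.sum_comm]
  congr 1
  refine Finset.sum_congr rfl fun τ _ => ?_
  rw [Finset.mul_sum]
  refine Finset.sum_congr rfl fun σ _ => ?_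
  rw [Units.smul_def, zsmul_eq_mul]
  simp only [pairProd, MultilinearMap.mk'_apply]
  ring

/-- `powTensor W k` as an alternating map in its second group of arguments. -/
theorem exists_alternating_right {W : V → V → V → V → ℝ} (hW : IsFourLinear W) (k : ℕ)
    (u : Fin (2 * k) → V) :
    ∃ A : V [⋀^Fin (2 * k)]→ₗ[ℝ] ℝ, ∀ v, A v = powTensor W k u v := by
  have hW' : IsFourLinear fun a b u v => W u v a b :=
    ⟨fun _ _ _ => hW.thd _ _ _, fun _ _ _ => hW.fth _ _ _,
      fun _ _ _ => hW.fst _ _ _, fun _ _ _ => hW.snd _ _ _⟩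
  obtain ⟨A, hA⟩ := exists_alternating_left hW' k u
  refine ⟨A, fun v => ?_⟩
  rw [hA, powTensor, powTensor, Finset.sum_comm]
  congr 1
  refine Finset.sum_congr rfl fun τ _ => Finset.sum_congr rfl fun σ _ => ?_
  rw [mul_comm ((Equiv.Perm.sign τ : ℤ) : ℝ)]

theorem existsUnique_powOperator {N : ℕ} (hN : 0 < N) (hV : finrank ℝ V = N)
    {B : LinearMap.BilinForm ℝ V} (hB : IsInner B) {W : V → V → V → V → ℝ} (hW : IsFourLinear W)
    (k : ℕ) :
    ∃! L : ⋀[ℝ]^(2 * k) V →ₗ[ℝ] ⋀[ℝ]^(2 * k) V, ∀ u v : Fin (2 * k) → V,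
      extInner B (2 * k) (L (exteriorPower.ιMulti ℝ (2 * k) u)) (exteriorPower.ιMulti ℝ (2 * k) v)
        = powTensor W k u v := by
  have : FiniteDimensional ℝ V := FiniteDimensional.of_finrank_pos (by omega)
  obtain ⟨e, he⟩ := exists_isPosONB hN hV hB (finBasisOfFinrankEq ℝ V hV).orientation
  choose AL hAL using exists_alternating_left hW k
  choose AR hAR using exists_alternating_right hW k
  let b := e.exteriorPower (2 * k)
  have hb : ∀ I, ∃ w : Fin (2 * k) → V, b I = exteriorPower.ιMulti ℝ (2 * k) w := fun I =>
    ⟨_, exteriorPower.basis_apply ℝ (2 * k) e I⟩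
  choose w hw using hb
  have hrepr : ∀ I x, extInner B (2 * k) (b I) x = b.repr x I := extInner_basis he.1 (2 * k)
  let L : ⋀[ℝ]^(2 * k) V →ₗ[ℝ] ⋀[ℝ]^(2 * k) V :=
    ∑ I, (LinearMap.toSpanSingleton ℝ _ (b I)) ∘ₗ
      exteriorPower.alternatingMapLinearEquiv (AL (w I))
  have hL : ∀ u v : Fin (2 * k) → V, extInner B (2 * k) (L (exteriorPower.ιMulti ℝ (2 * k) u))
      (exteriorPower.ιMulti ℝ (2 * k) v) = powTensor W k u v := by
    intro u v
    rw [← hAR u v, ← exteriorPower.alternatingMapLinearEquiv_apply_ιMulti (AR u) v]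
    refine LinearMap.congr_fun ?_ _
    refine b.ext fun J => ?_
    rw [hw J, exteriorPower.alternatingMapLinearEquiv_apply_ιMulti, hAR, ← hw J]
    simp [L, hrepr, hAL, Finsupp.single_apply]
  refine ⟨L, hL, ?_⟩
  · intro L' hL'
    have hext : ∀ x y : ⋀[ℝ]^(2 * k) V, (∀ v, extInner B (2 * k) x
        (exteriorPower.ιMulti ℝ (2 * k) v) = extInner B (2 * k) y
        (exteriorPower.ιMulti ℝ (2 * k) v)) → x = y := by
      have h0 : ∀ x J, extInner B (2 * k) x (b J) = b.repr x J := by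
        intro x J
        conv_lhs => rw [← b.sum_repr x]
        simp only [map_sum, LinearMap.sum_apply, map_smul, LinearMap.smul_apply, hrepr,
          Basis.repr_self, Finsupp.single_apply, smul_eq_mul]
        simp
      intro x y h
      refine b.repr.injective (Finsupp.ext fun J => ?_)
      rw [← h0, ← h0, hw J, h]
    refine exteriorPower.linearMap_ext (AlternatingMap.ext fun u => hext _ _ fun v => ?_)
    exact (hL' u v).trans (hL u v).symm

end Algebra

section Coordinates

/-! Curvature in coordinates: `G` is a field of bilinear forms `G x` on `ℝ^N`. -/

variable {N : ℕ}

/-- The coordinate space `ℝ^N`. -/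
abbrev Coord (N : ℕ) : Type := EuclideanSpace ℝ (Fin N)

/-- Christoffel symbols of the first kind, as a trilinear map; see `christoffelFirst_apply`. -/
def christoffelFirst (G : Coord N → Coord N →L[ℝ] Coord N →L[ℝ] ℝ) (x : Coord N) :
    Coord N →L[ℝ] Coord N →L[ℝ] Coord N →L[ℝ] ℝ :=
  let D : Coord N →L[ℝ] Coord N →L[ℝ] Coord N →L[ℝ] ℝ := fderiv ℝ G x
  let F : (Coord N →L[ℝ] Coord N →L[ℝ] ℝ) →L[ℝ] Coord N →L[ℝ] Coord N →L[ℝ] ℝ :=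
    (ContinuousLinearMap.flipₗᵢ ℝ (Coord N) (Coord N) ℝ).toContinuousLinearEquiv
  (1 / 2 : ℝ) • (D + D.flip - F.comp D.flip)

theorem christoffelFirst_apply (G : Coord N → Coord N →L[ℝ] Coord N →L[ℝ] ℝ)
    (x u v w : Coord N) :
    christoffelFirst G x u v w =
      1 / 2 * (fderiv ℝ G x u v w + fderiv ℝ G x v u w - fderiv ℝ G x w u v) := by
  rfl

/-- Christoffel symbols of the second kind, `Γ_x(u, v) = G_x⁻¹ (christoffelFirst G x u v)`:
the covariant derivative of the constant field `v` in the direction `u`. -/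
def christoffel (G : Coord N → Coord N →L[ℝ] Coord N →L[ℝ] ℝ) (x : Coord N) :
    Coord N →L[ℝ] Coord N →L[ℝ] Coord N :=
  (ContinuousLinearMap.compL ℝ (Coord N) (Coord N →L[ℝ] ℝ) (Coord N)
    (ContinuousLinearMap.inverse (G x))) ∘L christoffelFirst G x

/-- The curvature endomorphism `R(u, v) w = ∇_u ∇_v w - ∇_v ∇_u w` (for constant fields). -/
def curvEndo (G : Coord N → Coord N →L[ℝ] Coord N →L[ℝ] ℝ) (x u v w : Coord N) : Coord N :=
  fderiv ℝ (christoffel G) x u v w - fderiv ℝ (christoffel G) x v u w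
    + christoffel G x u (christoffel G x v w) - christoffel G x v (christoffel G x u w)

/-- The curvature `4`-tensor, `Rm(u, v, a, b) = ⟨R(u, v) b, a⟩`, so that `Rm(u, v, u, v)` is the
sectional curvature of the plane of orthonormal `u`, `v`. -/
def riemann (G : Coord N → Coord N →L[ℝ] Coord N →L[ℝ] ℝ) (x u v a b : Coord N) : ℝ :=
  G x (curvEndo G x u v b) a

/-- The `i`-th coordinate vector. -/
def stdVec (i : Fin N) : Coord N := EuclideanSpace.single i 1

/-- The Ricci tensor `Ric(v, w)`, the trace of `u ↦ R(u, v) w`. -/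
def ricci (G : Coord N → Coord N →L[ℝ] Coord N →L[ℝ] ℝ) (x v w : Coord N) : ℝ :=
  ∑ i, curvEndo G x (stdVec i) v w i

/-- The scalar curvature, the `G`-trace `∑ᵢ Ric((dxⁱ)^♯, ∂ᵢ)` of the Ricci tensor. -/
def scalarCurv (G : Coord N → Coord N →L[ℝ] Coord N →L[ℝ] ℝ) (x : Coord N) : ℝ :=
  ∑ i, ricci G x (ContinuousLinearMap.inverse (G x) (EuclideanSpace.proj i)) (stdVec i)

/-- The traceless Ricci tensor `Ric - (scal / N) g`. -/
def tracelessRicci (G : Coord N → Coord N →L[ℝ] Coord N →L[ℝ] ℝ) (x v w : Coord N) : ℝ :=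
  ricci G x v w - scalarCurv G x / N * G x v w

/-- The Kulkarni-Nomizu product `KN(h, k)` of two bilinear forms. -/
def kulkarniNomizu {V : Type*} (h k : V → V → ℝ) (u v a b : V) : ℝ :=
  h u a * k v b + h v b * k u a - h u b * k v a - h v a * k u b

/-- The Weyl tensor `W`, given by
`Rm = W + 1 / (N - 2) KN(Ric₀, g) + scal / (2 N (N - 1)) KN(g, g)`. -/
def weyl (G : Coord N → Coord N →L[ℝ] Coord N →L[ℝ] ℝ) (x u v a b : Coord N) : ℝ :=
  riemann G x u v a b
    - 1 / ((N : ℝ) - 2) *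
        kulkarniNomizu (tracelessRicci G x) (fun v w => G x v w) u v a b
    - scalarCurv G x / (2 * N * ((N : ℝ) - 1)) *
        kulkarniNomizu (fun v w => G x v w) (fun v w => G x v w) u v a b

theorem isFourLinear_weyl (G : Coord N → Coord N →L[ℝ] Coord N →L[ℝ] ℝ) (x : Coord N) :
    IsFourLinear (weyl G x) := by
  constructor <;> intro p q r <;> constructor <;> intros <;>
    simp only [weyl, riemann, kulkarniNomizu, tracelessRicci, ricci, curvEndo, map_add, map_sub,
      map_smul, _root_.add_apply, _root_.sub_apply,
      _root_.smul_apply, PiLp.add_apply, PiLp.sub_apply, PiLp.smul_apply,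
      Finset.sum_add_distrib, Finset.sum_sub_distrib, smul_eq_mul, ← Finset.mul_sum] <;> ring

end Coordinates

section Manifold

variable {N : ℕ} {M : Type*} [TopologicalSpace M] [ChartedSpace (Coord N) M]

/-- The tangent space `T_q M`. -/
abbrev Tan (N : ℕ) {M : Type*} [TopologicalSpace M] [ChartedSpace (Coord N) M] (q : M) : Type :=
  TangentSpace 𝓘(ℝ, Coord N) q

theorem finrank_tan (q : M) : finrank ℝ (Tan N q) = N :=
  (finrank_euclideanSpace_fin : finrank ℝ (Coord N) = N)

/-- Smooth Riemannian metrics on the smooth `N`-manifold `M`. -/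
abbrev RiemMetric (N : ℕ) (M : Type*) [TopologicalSpace M] [ChartedSpace (Coord N) M]
    [IsManifold 𝓘(ℝ, Coord N) ∞ M] : Type _ :=
  Bundle.ContMDiffRiemannianMetric 𝓘(ℝ, Coord N) ∞ (Coord N) (fun q : M => Tan N q)

/-- An orientation of the manifold `M`: an orientation of every tangent space which is locally
constant in the charts, i.e. in the local trivializations of the tangent bundle. -/
structure ManifoldOrientation (N : ℕ) (M : Type*) [TopologicalSpace M] [ChartedSpace (Coord N) M]
    [IsManifold 𝓘(ℝ, Coord N) ∞ M] where
  /-- The orientation of the tangent space at a point. -/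
  at_ : ∀ q : M, Orientation ℝ (Tan N q) (Fin N)
  locallyConstant : ∀ q : M, ∃ o₀ : Orientation ℝ (Coord N) (Fin N), ∀ᶠ x in nhds q,
    ∀ hx : x ∈ (trivializationAt (Coord N) (fun q : M => Tan N q) q).baseSet,
      Orientation.map (Fin N)
        ((trivializationAt (Coord N) (fun q : M => Tan N q) q).linearEquivAt ℝ x hx) (at_ x) = o₀

variable [IsManifold 𝓘(ℝ, Coord N) ∞ M]

/-- `g' = e^{2f} g` for a smooth function `f`. -/
def IsConformalTo (g g' : RiemMetric N M) : Prop :=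
  ∃ f : M → ℝ, ContMDiff 𝓘(ℝ, Coord N) 𝓘(ℝ, ℝ) ∞ f ∧
    ∀ (q : M) (u v : Tan N q), g'.inner q u v = Real.exp (2 * f q) * g.inner q u v

/-- The inner product `g_q` on `T_q M`. -/
def metricAt (g : RiemMetric N M) (q : M) : LinearMap.BilinForm ℝ (Tan N q) :=
  LinearMap.mk₂ ℝ (fun u v => g.inner q u v) (by simp) (by simp) (by simp) (by simp)

theorem isInner_metricAt (g : RiemMetric N M) (q : M) : IsInner (metricAt g q) :=
  ⟨g.symm q, g.pos q⟩

/-- The metric in the chart `φ` at `q`: the pull-back `(φ⁻¹)^* g` on the coordinate space. -/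
def chartMetric (g : RiemMetric N M) (q : M) (y : Coord N) :
    Coord N →L[ℝ] Coord N →L[ℝ] ℝ :=
  let φ := extChartAt 𝓘(ℝ, Coord N) q
  let d : Coord N →L[ℝ] Coord N := mfderiv 𝓘(ℝ, Coord N) 𝓘(ℝ, Coord N) φ.symm y
  ContinuousLinearMap.bilinearComp
    (show Coord N →L[ℝ] Coord N →L[ℝ] ℝ from g.inner (φ.symm y)) d d

theorem chartMetric_apply (g : RiemMetric N M) (q : M) (y a b : Coord N) :
    chartMetric g q y a b = g.inner ((extChartAt 𝓘(ℝ, Coord N) q).symm y)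
      (mfderiv 𝓘(ℝ, Coord N) 𝓘(ℝ, Coord N) (extChartAt 𝓘(ℝ, Coord N) q).symm y a)
      (mfderiv 𝓘(ℝ, Coord N) 𝓘(ℝ, Coord N) (extChartAt 𝓘(ℝ, Coord N) q).symm y b) :=
  rfl

/-- The differential at `q` of the chart `φ` at `q`. -/
def chartDiff (q : M) : Tan N q →L[ℝ] Coord N :=
  mfderiv 𝓘(ℝ, Coord N) 𝓘(ℝ, Coord N) (extChartAt 𝓘(ℝ, Coord N) q) q

/-- The Weyl tensor of `g` on `T_q M`, computed in the chart at `q`. -/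
def weylTensor (g : RiemMetric N M) (q : M) (u v a b : Tan N q) : ℝ :=
  weyl (chartMetric g q) (extChartAt 𝓘(ℝ, Coord N) q q)
    (chartDiff q u) (chartDiff q v) (chartDiff q a) (chartDiff q b)

theorem isFourLinear_weylTensor (g : RiemMetric N M) (q : M) : IsFourLinear (weylTensor g q) := by
  have h := isFourLinear_weyl (chartMetric g q) (extChartAt 𝓘(ℝ, Coord N) q q)
  constructor
  · intro v a b
    exact ⟨fun x y => by simp only [weylTensor, map_add, (h.fst _ _ _).map_add],
      fun c x => by simp only [weylTensor, map_smul, (h.fst _ _ _).map_smul]⟩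
  · intro v a b
    exact ⟨fun x y => by simp only [weylTensor, map_add, (h.snd _ _ _).map_add],
      fun c x => by simp only [weylTensor, map_smul, (h.snd _ _ _).map_smul]⟩
  · intro v a b
    exact ⟨fun x y => by simp only [weylTensor, map_add, (h.thd _ _ _).map_add],
      fun c x => by simp only [weylTensor, map_smul, (h.thd _ _ _).map_smul]⟩
  · intro v a b
    exact ⟨fun x y => by simp only [weylTensor, map_add, (h.fth _ _ _).map_add],
      fun c x => by simp only [weylTensor, map_smul, (h.fth _ _ _).map_smul]⟩

end Manifold

section MiddleDimension

variable {n : ℕ} {M : Type*} [TopologicalSpace M] [ChartedSpace (Coord (4 * n)) M]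
  [IsManifold 𝓘(ℝ, Coord (4 * n)) ∞ M]

/-- `Λ^{2n} T_q M` on a `4n`-manifold. -/
abbrev Mid (n : ℕ) {M : Type*} [TopologicalSpace M] [ChartedSpace (Coord (4 * n)) M] (q : M) :
    Type :=
  ⋀[ℝ]^(2 * n) (Tan (4 * n) q)

/-- The Hodge star operator `Λ^{2n} T_q M → Λ^{2n} T_q M` of an oriented Riemannian
`4n`-manifold. -/
def hodgeStar (hn : 0 < n) (o : ManifoldOrientation (4 * n) M) (g : RiemMetric (4 * n) M) (q : M) :
    Mid n q →ₗ[ℝ] Mid n q :=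
  (existsUnique_isHodgeStar (p := 2 * n) (q := 2 * n) (by omega) (finrank_tan q) (by omega)
    (isInner_metricAt g q) (o.at_ q)).choose

theorem hodgeStar_spec (hn : 0 < n) (o : ManifoldOrientation (4 * n) M)
    (g : RiemMetric (4 * n) M) (q : M) :
    IsHodgeStar (metricAt g q) (o.at_ q) (hodgeStar hn o g q) :=
  (existsUnique_isHodgeStar (p := 2 * n) (q := 2 * n) (by omega) (finrank_tan q) (by omega)
    (isInner_metricAt g q) (o.at_ q)).choose_spec.1

/-- The `2n`-th Weyl curvature operator `Ŵ_{2n}` on `Λ^{2n} T_q M`: the endomorphism with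
`⟨Ŵ_{2n}(u₁ ∧ ⋯ ∧ u_{2n}), v₁ ∧ ⋯ ∧ v_{2n}⟩ = W_{2n}(u₁, …, u_{2n}, v₁, …, v_{2n})`. -/
def weylOp (hn : 0 < n) (g : RiemMetric (4 * n) M) (q : M) : Mid n q →ₗ[ℝ] Mid n q :=
  (existsUnique_powOperator (by omega : 0 < 4 * n) (finrank_tan q) (isInner_metricAt g q)
    (isFourLinear_weylTensor g q) n).choose

theorem weylOp_spec (hn : 0 < n) (g : RiemMetric (4 * n) M) (q : M)
    (u v : Fin (2 * n) → Tan (4 * n) q) :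
    extInner (metricAt g q) (2 * n) (weylOp hn g q (exteriorPower.ιMulti ℝ (2 * n) u))
      (exteriorPower.ιMulti ℝ (2 * n) v) = powTensor (weylTensor g q) n u v :=
  (existsUnique_powOperator (by omega : 0 < 4 * n) (finrank_tan q) (isInner_metricAt g q)
    (isFourLinear_weylTensor g q) n).choose_spec.1 u v

/-- The commuting condition `* Ŵ_{2n} = Ŵ_{2n} *` at the point `q`. -/
def StarCommutes (hn : 0 < n) (o : ManifoldOrientation (4 * n) M) (g : RiemMetric (4 * n) M)
    (q : M) : Prop :=
  hodgeStar hn o g q ∘ₗ weylOp hn g q = weylOp hn g q ∘ₗ hodgeStar hn o g q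

/-- Half of the dimension `(4n choose 2n)` of `Λ^{2n} T_q M`. -/
def halfDim (n : ℕ) : ℕ := (4 * n).choose (2 * n) / 2

/-- A Hodge basis of `Λ^{2n} T_q M`: an orthonormal basis, split into two halves of the same size,
in which the Hodge star has the block matrix `[[0, I], [I, 0]]`. -/
structure IsHodgeBasis (hn : 0 < n) (o : ManifoldOrientation (4 * n) M) (g : RiemMetric (4 * n) M)
    (q : M) (b : Basis (Fin (halfDim n) ⊕ Fin (halfDim n)) ℝ (Mid n q)) : Prop where
  orthonormal : ∀ k l, extInner (metricAt g q) (2 * n) (b k) (b l) = if k = l then 1 else 0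
  star : LinearMap.toMatrix b b (hodgeStar hn o g q) = Matrix.fromBlocks 0 1 1 0

/-- The basis `b` of `Λ^{2n} T_q M` consists of vectors `e_{i₁} ∧ ⋯ ∧ e_{i_{2n}}`. -/
def ArisesFrom {q : M} (e : Basis (Fin (4 * n)) ℝ (Tan (4 * n) q))
    (b : Basis (Fin (halfDim n) ⊕ Fin (halfDim n)) ℝ (Mid n q)) : Prop :=
  ∀ k, ∃ s : Fin (2 * n) → Fin (4 * n), b k = exteriorPower.ιMulti ℝ (2 * n) fun i => e (s i)

/-- In the basis `b`, the operator `Ŵ_{2n}` has the block form `[[A, B], [B, A]]`. -/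
def HasBlockForm (hn : 0 < n) (g : RiemMetric (4 * n) M) (q : M)
    (b : Basis (Fin (halfDim n) ⊕ Fin (halfDim n)) ℝ (Mid n q))
    (A B : Matrix (Fin (halfDim n)) (Fin (halfDim n)) ℝ) : Prop :=
  LinearMap.toMatrix b b (weylOp hn g q) = Matrix.fromBlocks A B B A

/-- The condition `B = ε A` (for `ε = ±1`) at the point `q`: in some Hodge basis arising from an
oriented orthonormal basis of `T_q M`, `Ŵ_{2n}` has the form `[[A, B], [B, A]]` with `B = ε A`. -/
def BlocksProportional (ε : ℝ) (hn : 0 < n) (o : ManifoldOrientation (4 * n) M)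
    (g : RiemMetric (4 * n) M) (q : M) : Prop :=
  ∃ (e : Basis (Fin (4 * n)) ℝ (Tan (4 * n) q))
    (b : Basis (Fin (halfDim n) ⊕ Fin (halfDim n)) ℝ (Mid n q)),
    IsPosONB (metricAt g q) (o.at_ q) e ∧ ArisesFrom e b ∧ IsHodgeBasis hn o g q b ∧
      ∃ A B, HasBlockForm hn g q b A B ∧ B = ε • A

/-- For `ε = ±1`, the orthogonal projection `½ (1 + ε *)` of `Λ^{2n}` onto the `ε`-eigenspace
`Λ^{2n}_±` of the Hodge star. -/
def eigenProj (ε : ℝ) (hn : 0 < n) (o : ManifoldOrientation (4 * n) M) (g : RiemMetric (4 * n) M)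
    (q : M) : Mid n q →ₗ[ℝ] Mid n q :=
  (1 / 2 : ℝ) • (LinearMap.id + ε • hodgeStar hn o g q)

/-- The self-dual (`ε = 1`) and anti-self-dual (`ε = -1`) part of `Ŵ_{2n}`: its block
`Λ^{2n}_± → Λ^{2n}_±`, extended by zero. -/
def weylPart (ε : ℝ) (hn : 0 < n) (o : ManifoldOrientation (4 * n) M) (g : RiemMetric (4 * n) M)
    (q : M) : Mid n q →ₗ[ℝ] Mid n q :=
  eigenProj ε hn o g q ∘ₗ weylOp hn g q ∘ₗ eigenProj ε hn o g q

end MiddleDimension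

end HigherWeyl

end

open HigherWeyl

/-! Conformal invariance is a matter of weights. If `g' = c g` at `q` with `c = e^{2f(q)}`, the
covariant Weyl tensor is multiplied by `c`, hence the `2n`-th power tensor by `c^n`, while the inner
product of `Λ^{2n}` is multiplied by `c^{2n}`; so the operator `Ŵ_{2n}` is multiplied by `c^{-n}`.
In the middle dimension the star does not change: the factor `c^{2n}` of the inner product is
compensated by the factor `c^{-2n}` of `e₁ ∧ ⋯ ∧ e_{4n}`. All conditions considered are linear
homogeneous in `Ŵ_{2n}` and otherwise involve only `*`. The analytic input is
`IsMetricNear.weyl_conformal`: the curvature changes by a Kulkarni–Nomizu product with the metric,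
which is what the Weyl tensor discards.

The block statements are matrix algebra (`comm_iff_blocks`, `proportional_iff_blocks`). Commuting
with `[[0, I], [I, 0]]` means that the blocks agree in pairs, and then the compression by `½(1 - ε
*)` has blocks `±½(A - εB)` up to the factor `ε`, so it vanishes exactly when `B = εA`. This
criterion does not mention the basis, whence independence of it. Hodge bases exist because `* e_J =
± e_{J^c}` and `** = 1` in even degree.

For `n = 1`, symmetry and trace-freeness of `W` force each component on a pair of planes to equal
the one on the complementary planes (`curvature_comp_dim_four`), which is commutation with `*`. -/

namespace HigherWeyl

/-! ### Levi-Civita connection and curvature in coordinates -/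

section LeviCivita

variable {N : ℕ}

/-- `G` is, near `x`, a `C^2` field of nondegenerate symmetric bilinear forms. -/
structure IsMetricNear (G : Coord N → Coord N →L[ℝ] Coord N →L[ℝ] ℝ) (x : Coord N) : Prop where
  contDiffAt : ContDiffAt ℝ 2 G x
  symm : ∀ y u v, G y u v = G y v u
  invertible : (G x).IsInvertible

variable {G : Coord N → Coord N →L[ℝ] Coord N →L[ℝ] ℝ} {x : Coord N}

theorem apply_inverse_apply {A : Coord N →L[ℝ] Coord N →L[ℝ] ℝ} (hA : A.IsInvertible)
    (φ : Coord N →L[ℝ] ℝ) : A (A.inverse φ) = φ :=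
  ((hA.inverse_apply_eq (x := A.inverse φ) (y := φ)).1 rfl).symm

/-- Invertible operators form an open set. This lets pointwise identities be differentiated at `x`.
-/
theorem IsMetricNear.eventually (h : IsMetricNear G x) : ∀ᶠ y in nhds x, IsMetricNear G y := by
  have h1 : ∀ᶠ y in nhds x, ContDiffAt ℝ 2 G y := h.contDiffAt.eventually (by simp)
  have h2 : ∀ᶠ y in nhds x, (G y).IsInvertible :=
    h.contDiffAt.continuousAt.eventually
      (ContinuousLinearEquiv.isOpen.mem_nhds (by simpa using! h.invertible))
  filter_upwards [h1, h2] with y hy1 hy2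
  exact ⟨hy1, h.symm, hy2⟩

theorem IsMetricNear.differentiableAt (h : IsMetricNear G x) : DifferentiableAt ℝ G x :=
  h.contDiffAt.differentiableAt (by simp)

theorem IsMetricNear.contDiffAt_fderiv (h : IsMetricNear G x) :
    ContDiffAt ℝ 1 (fderiv ℝ G) x :=
  h.contDiffAt.fderiv_right (by norm_num)

theorem IsMetricNear.fderiv_symm (h : IsMetricNear G x) (u a b : Coord N) :
    fderiv ℝ G x u a b = fderiv ℝ G x u b a := by
  have h1 : HasFDerivAt (fun y => G y a b) _ x :=
    (h.differentiableAt.hasFDerivAt.clm_apply (hasFDerivAt_const a x)).clm_apply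
      (hasFDerivAt_const b x)
  have h2 : HasFDerivAt (fun y => G y b a) _ x :=
    (h.differentiableAt.hasFDerivAt.clm_apply (hasFDerivAt_const b x)).clm_apply
      (hasFDerivAt_const a x)
  have h3 : (fun y => G y a b) = fun y => G y b a := funext fun y => h.symm y a b
  rw [h3] at h1
  simpa using DFunLike.congr_fun (h1.unique h2) u

theorem IsMetricNear.apply_christoffel (h : IsMetricNear G x) (u v w : Coord N) :
    G x (christoffel G x u v) w = christoffelFirst G x u v w :=
  DFunLike.congr_fun (apply_inverse_apply h.invertible (christoffelFirst G x u v)) w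

theorem IsMetricNear.ext_apply (h : IsMetricNear G x) {a b : Coord N}
    (hab : ∀ w, G x a w = G x b w) : a = b := by
  obtain ⟨A, hA⟩ := h.invertible
  apply A.injective
  ext w
  have := hab w
  rw [← hA] at this
  simpa using! this

theorem IsMetricNear.christoffel_symm (h : IsMetricNear G x) (u v : Coord N) :
    christoffel G x u v = christoffel G x v u := by
  refine h.ext_apply fun w => ?_
  rw [h.apply_christoffel, h.apply_christoffel, christoffelFirst_apply, christoffelFirst_apply,
    h.fderiv_symm w u v]
  ring

/-- Metric compatibility `∇G = 0`, from the Koszul formula: the terms antisymmetric in `a`, `b`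
cancel. -/
theorem IsMetricNear.compat (h : IsMetricNear G x) (u a b : Coord N) :
    fderiv ℝ G x u a b = G x (christoffel G x u a) b + G x (christoffel G x u b) a := by
  rw [h.apply_christoffel, h.apply_christoffel, christoffelFirst_apply, christoffelFirst_apply,
    h.fderiv_symm u b a, h.fderiv_symm a u b, h.fderiv_symm b u a]
  ring

theorem IsMetricNear.differentiableAt_inverse (h : IsMetricNear G x) :
    DifferentiableAt ℝ (fun y => ContinuousLinearMap.inverse (G y)) x :=
  ((h.invertible.contDiffAt_map_inverse (n := 1)).differentiableAt (by simp)).comp x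
    h.differentiableAt

theorem IsMetricNear.differentiableAt_christoffel (h : IsMetricNear G x) :
    DifferentiableAt ℝ (christoffel G) x := by
  have hD : DifferentiableAt ℝ (fderiv ℝ G) x := h.contDiffAt_fderiv.differentiableAt (by simp)
  have h1 : DifferentiableAt ℝ (christoffelFirst G) x := by
    let fl := (ContinuousLinearMap.flipₗᵢ ℝ (Coord N) (Coord N)
      (Coord N →L[ℝ] ℝ)).toContinuousLinearEquiv.toContinuousLinearMap
    let F : (Coord N →L[ℝ] Coord N →L[ℝ] ℝ) →L[ℝ] Coord N →L[ℝ] Coord N →L[ℝ] ℝ :=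
      (ContinuousLinearMap.flipₗᵢ ℝ (Coord N) (Coord N) ℝ).toContinuousLinearEquiv
    have hfl : DifferentiableAt ℝ (fun y => fl (fderiv ℝ G y)) x :=
      fl.differentiableAt.comp x hD
    have hF : DifferentiableAt ℝ (fun y => F.comp (fl (fderiv ℝ G y))) x :=
      (differentiableAt_const F).clm_comp hfl
    exact ((hD.add hfl).sub hF).const_smul (1 / 2 : ℝ)
  exact ((ContinuousLinearMap.compL ℝ (Coord N) (Coord N →L[ℝ] ℝ) (Coord N)).differentiableAt.comp x
    h.differentiableAt_inverse).clm_comp h1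

theorem IsMetricNear.hasFDerivAt_christoffel (h : IsMetricNear G x) (v w : Coord N) :
    HasFDerivAt (fun y => christoffel G y v w)
      (((fderiv ℝ (christoffel G) x).flip v).flip w) x := by
  have := (h.differentiableAt_christoffel.hasFDerivAt.clm_apply (hasFDerivAt_const v x)).clm_apply
      (hasFDerivAt_const w x)
  refine this.congr_fderiv ?_
  ext u
  simp

theorem IsMetricNear.fderiv_christoffel_symm (h : IsMetricNear G x) (u v w : Coord N) :
    fderiv ℝ (christoffel G) x u v w = fderiv ℝ (christoffel G) x u w v := by
  have h1 := h.hasFDerivAt_christoffel v w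
  have h2 := h.hasFDerivAt_christoffel w v
  have h3 : (fun y => christoffel G y v w) =ᶠ[nhds x] fun y => christoffel G y w v :=
    h.eventually.mono fun y hy => hy.christoffel_symm v w
  exact DFunLike.congr_fun (h1.unique (h2.congr_of_eventuallyEq h3)) u

/-- First Bianchi identity. -/
theorem IsMetricNear.curvEndo_bianchi (h : IsMetricNear G x) (u v w : Coord N) :
    curvEndo G x u v w + curvEndo G x v w u + curvEndo G x w u v = 0 := by
  simp only [curvEndo]
  rw [h.fderiv_christoffel_symm u v w, h.fderiv_christoffel_symm v w u,
    h.fderiv_christoffel_symm w u v, h.christoffel_symm u v, h.christoffel_symm v w,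
    h.christoffel_symm w u]
  abel

theorem IsMetricNear.isSymm_fderiv (h : IsMetricNear G x) (u v : Coord N) :
    fderiv ℝ (fderiv ℝ G) x u v = fderiv ℝ (fderiv ℝ G) x v u :=
  (h.contDiffAt.isSymmSndFDerivAt (by simp)) u v

/-- Second derivatives of the metric in terms of the Christoffel symbols. -/
theorem IsMetricNear.fderiv_fderiv (h : IsMetricNear G x) (u v b : Coord N) :
    fderiv ℝ (fderiv ℝ G) x u v b b =
      2 * (G x (christoffel G x u (christoffel G x v b)) b +
        G x (christoffel G x u b) (christoffel G x v b) +
        G x (fderiv ℝ (christoffel G) x u v b) b) := by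
  have hD : DifferentiableAt ℝ (fderiv ℝ G) x := h.contDiffAt_fderiv.differentiableAt (by simp)
  have h1 := ((hD.hasFDerivAt.clm_apply (hasFDerivAt_const v x)).clm_apply
    (hasFDerivAt_const b x)).clm_apply (hasFDerivAt_const b x)
  have h2 := ((h.differentiableAt.hasFDerivAt.clm_apply
    (h.hasFDerivAt_christoffel v b)).clm_apply (hasFDerivAt_const b x)).const_mul (2 : ℝ)
  -- Compatibility on the diagonal, valid in a neighbourhood of `x`; both sides are then
  -- differentiated in the direction `u`.
  have h3 : (fun y => fderiv ℝ G y v b b) =ᶠ[nhds x] fun y => 2 * G y (christoffel G y v b) b :=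
    h.eventually.mono fun y hy => by
      simp only [hy.compat]; ring
  have h4 := DFunLike.congr_fun (h1.unique (h2.congr_of_eventuallyEq h3)) u
  simp at h4
  rw [h4, h.compat]
  ring

theorem riemann_skew_left (u v a b : Coord N) : riemann G x u v a b = -riemann G x v u a b := by
  have h : curvEndo G x u v b = -curvEndo G x v u b := by
    simp only [curvEndo]
    abel
  simp [riemann, h]

/-- The second derivative of `G(b, b)` is symmetric in `u`, `v`; antisymmetrizing `fderiv_fderiv`
leaves `2 G(R(u, v) b, b) = 0`. -/
theorem IsMetricNear.riemann_self_right (h : IsMetricNear G x) (u v b : Coord N) :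
    riemann G x u v b b = 0 := by
  have h1 := h.fderiv_fderiv u v b
  have h2 := h.fderiv_fderiv v u b
  rw [h.isSymm_fderiv] at h1
  have h3 := h.symm x (christoffel G x u b) (christoffel G x v b)
  simp only [riemann, curvEndo, map_add, map_sub, _root_.add_apply, _root_.sub_apply]
  linarith

end LeviCivita

end HigherWeyl

namespace HigherWeyl

/-! ### Conformal change of the connection and of the curvature -/

section Conformal

variable {N : ℕ}

/-- The gradient of `F` with respect to `G`. -/
noncomputable def gradient (G : Coord N → Coord N →L[ℝ] Coord N →L[ℝ] ℝ) (F : Coord N → ℝ) (x : Coord N) :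
    Coord N :=
  ContinuousLinearMap.inverse (G x) (fderiv ℝ F x)

/-- The tensor `Hess F - dF ⊗ dF + ½ |dF|² G` measuring the change of curvature under a conformal
change of `G` by `e^{2F}`. -/
noncomputable def conformalHess (G : Coord N → Coord N →L[ℝ] Coord N →L[ℝ] ℝ) (F : Coord N → ℝ)
    (x u v : Coord N) : ℝ :=
  fderiv ℝ (fderiv ℝ F) x u v - fderiv ℝ F x (christoffel G x u v) - fderiv ℝ F x u * fderiv ℝ F x v
    + 1 / 2 * fderiv ℝ F x (gradient G F x) * G x u v

variable {G G' : Coord N → Coord N →L[ℝ] Coord N →L[ℝ] ℝ} {F : Coord N → ℝ} {x : Coord N}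

theorem IsMetricNear.apply_gradient (h : IsMetricNear G x) (w : Coord N) :
    G x (gradient G F x) w = fderiv ℝ F x w :=
  DFunLike.congr_fun (apply_inverse_apply h.invertible (fderiv ℝ F x)) w

theorem IsMetricNear.conformal (h : IsMetricNear G x) (hF : ContDiffAt ℝ 2 F x)
    (hG' : ∀ y, G' y = Real.exp (2 * F y) • G y) : IsMetricNear G' x := by
  refine ⟨?_, fun y u v => ?_, ?_⟩
  · rw [show G' = fun y => Real.exp (2 * F y) • G y from funext hG']
    exact ((contDiffAt_const.mul hF).exp).smul h.contDiffAt
  · simp [hG', h.symm y u v]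
  · obtain ⟨A, hA⟩ := h.invertible
    rw [hG', ← hA]
    refine ⟨(ContinuousLinearEquiv.smulLeft (Units.mk0 _ (Real.exp_ne_zero (2 * F x)))).trans A, ?_⟩
    ext u v
    simp [Units.smul_def]

/-- Differentiating `e^{2F}` in the Koszul formula adds `dF(u) G(v, w) + dF(v) G(u, w) - dF(w) G(u,
v)` before the common factor is removed. -/
theorem IsMetricNear.christoffel_conformal (h : IsMetricNear G x) (hF : ContDiffAt ℝ 2 F x)
    (hG' : ∀ y, G' y = Real.exp (2 * F y) • G y) (u v : Coord N) :
    christoffel G' x u v = christoffel G x u v + fderiv ℝ F x u • v + fderiv ℝ F x v • u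
      - G x u v • gradient G F x := by
  have h' := h.conformal hF hG'
  have hd : ∀ u v w, fderiv ℝ G' x u v w =
      Real.exp (2 * F x) * (2 * fderiv ℝ F x u * G x v w + fderiv ℝ G x u v w) := by
    intro u v w
    have hF1 : HasFDerivAt F (fderiv ℝ F x) x := (hF.differentiableAt (by simp)).hasFDerivAt
    have h1 := ((hF1.const_mul (2 : ℝ)).exp).smul h.differentiableAt.hasFDerivAt
    rw [← show G' = (fun y => Real.exp (2 * F y)) • G from funext hG'] at h1
    rw [h1.fderiv]
    simp
    ring
  refine h'.ext_apply fun w => ?_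
  rw [h'.apply_christoffel, christoffelFirst_apply, hd, hd, hd, hG']
  simp only [_root_.smul_apply, map_add, map_sub, map_smul, _root_.add_apply, _root_.sub_apply,
    smul_eq_mul, h.apply_christoffel, christoffelFirst_apply, h.apply_gradient]
  ring

theorem IsMetricNear.differentiableAt_gradient (h : IsMetricNear G x) (hF : ContDiffAt ℝ 2 F x) :
    DifferentiableAt ℝ (gradient G F) x :=
  h.differentiableAt_inverse.clm_apply
    ((hF.fderiv_right (m := 1) (by norm_num)).differentiableAt (by simp))

/-- Obtained by differentiating `G(∇F, w) = dF(w)` and eliminating the derivative of `G` by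
compatibility. -/
theorem IsMetricNear.apply_fderiv_gradient (h : IsMetricNear G x) (hF : ContDiffAt ℝ 2 F x)
    (u w : Coord N) :
    G x (fderiv ℝ (gradient G F) x u) w = fderiv ℝ (fderiv ℝ F) x u w
      - G x (christoffel G x u (gradient G F x)) w - fderiv ℝ F x (christoffel G x u w) := by
  have hF2 : DifferentiableAt ℝ (fderiv ℝ F) x :=
    (hF.fderiv_right (m := 1) (by norm_num)).differentiableAt (by simp)
  have h1 := (h.differentiableAt.hasFDerivAt.clm_apply
    (h.differentiableAt_gradient hF).hasFDerivAt).clm_apply (hasFDerivAt_const w x)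
  have h2 := hF2.hasFDerivAt.clm_apply (hasFDerivAt_const w x)
  have h3 : (fun y => G y (gradient G F y) w) =ᶠ[nhds x] fun y => fderiv ℝ F y w :=
    h.eventually.mono fun y hy => hy.apply_gradient w
  have h4 := DFunLike.congr_fun (h1.unique (h2.congr_of_eventuallyEq h3)) u
  simp at h4
  rw [h.compat, h.symm x (christoffel G x u w), h.apply_gradient] at h4
  linarith

theorem IsMetricNear.fderiv_christoffel_conformal (h : IsMetricNear G x)
    (hF : ContDiffAt ℝ 2 F x) (hG' : ∀ y, G' y = Real.exp (2 * F y) • G y) (u v w : Coord N) :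
    fderiv ℝ (christoffel G') x u v w = fderiv ℝ (christoffel G) x u v w
      + fderiv ℝ (fderiv ℝ F) x u v • w + fderiv ℝ (fderiv ℝ F) x u w • v
      - (G x v w • fderiv ℝ (gradient G F) x u + fderiv ℝ G x u v w • gradient G F x) := by
  have hF2 : DifferentiableAt ℝ (fderiv ℝ F) x :=
    (hF.fderiv_right (m := 1) (by norm_num)).differentiableAt (by simp)
  have hF3 : ∀ v, HasFDerivAt (fun y => fderiv ℝ F y v) _ x := fun v =>
    hF2.hasFDerivAt.clm_apply (hasFDerivAt_const v x)
  have hF' : ∀ᶠ y in nhds x, ContDiffAt ℝ 2 F y := hF.eventually (by simp)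
  have h1 := (h.conformal hF hG').hasFDerivAt_christoffel v w
  have h2 := (((h.hasFDerivAt_christoffel v w).add ((hF3 v).smul (hasFDerivAt_const w x))).add
    ((hF3 w).smul (hasFDerivAt_const v x))).sub
      (((h.differentiableAt.hasFDerivAt.clm_apply (hasFDerivAt_const v x)).clm_apply
        (hasFDerivAt_const w x)).smul (h.differentiableAt_gradient hF).hasFDerivAt)
  have h3 : (fun y => christoffel G' y v w) =ᶠ[nhds x] fun y => christoffel G y v w +
      fderiv ℝ F y v • w + fderiv ℝ F y w • v - G y v w • gradient G F y :=
    (h.eventually.and hF').mono fun y hy => hy.1.christoffel_conformal hy.2 hG' v w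
  have h4 := DFunLike.congr_fun (h1.unique (h2.congr_of_eventuallyEq h3)) u
  simpa using h4

/-- The change of the curvature tensor under a conformal change of the metric. -/
theorem IsMetricNear.riemann_conformal (h : IsMetricNear G x) (hF : ContDiffAt ℝ 2 F x)
    (hG' : ∀ y, G' y = Real.exp (2 * F y) • G y) (u v a b : Coord N) :
    riemann G' x u v a b = Real.exp (2 * F x) *
      (riemann G x u v a b
        - kulkarniNomizu (conformalHess G F x) (fun v w => G x v w) u v a b) := by
  have hs : fderiv ℝ (fderiv ℝ F) x u v = fderiv ℝ (fderiv ℝ F) x v u :=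
    (hF.isSymmSndFDerivAt (by simp)) u v
  -- Compatibility removes the explicit first derivatives of `G`, and the previous lemma those of
  -- the gradient; up to symmetries, a polynomial identity remains.
  simp only [riemann, curvEndo, h.fderiv_christoffel_conformal hF hG',
    h.christoffel_conformal hF hG', hG', kulkarniNomizu, conformalHess, hs,
    _root_.smul_apply, map_add, map_sub, map_smul, _root_.add_apply, _root_.sub_apply,
    smul_eq_mul, h.apply_gradient, h.apply_fderiv_gradient hF, h.compat]
  rw [h.symm x v u, h.symm x (christoffel G x u b) v, h.symm x v (gradient G F x),
    h.symm x u (gradient G F x), h.apply_gradient, h.apply_gradient,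
    h.symm x (christoffel G x v b) u, h.christoffel_symm v u]
  ring

end Conformal

end HigherWeyl

namespace HigherWeyl

/-! ### Metric traces and conformal covariance of the Weyl tensor -/

section Trace

variable {N : ℕ}

/-- `h` is linear in each of its two arguments. -/
structure IsTwoLinear {V : Type*} [AddCommGroup V] [Module ℝ V] (h : V → V → ℝ) : Prop where
  fst : ∀ v, IsLinearMap ℝ fun u => h u v
  snd : ∀ u, IsLinearMap ℝ fun v => h u v

/-- The basis dual to the standard basis with respect to `A`. -/
noncomputable def dualVec (A : Coord N →L[ℝ] Coord N →L[ℝ] ℝ) (i : Fin N) : Coord N :=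
  A.inverse (EuclideanSpace.proj i)

variable {A : Coord N →L[ℝ] Coord N →L[ℝ] ℝ}

theorem apply_dualVec (hA : A.IsInvertible) (i : Fin N) (w : Coord N) :
    A (dualVec A i) w = w i := by
  rw [dualVec, apply_inverse_apply hA]
  rfl

theorem sum_smul_stdVec (w : Coord N) : ∑ i, w i • stdVec i = w := by
  ext j
  simp [stdVec, Pi.single_apply]

theorem sum_smul_dualVec (hA : A.IsInvertible) (w : Coord N) :
    ∑ i, A w (stdVec i) • dualVec A i = w := by
  obtain ⟨B, hB⟩ := id hA
  apply B.injective
  ext z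
  rw [show ∀ u, B u = A u from fun u => by rw [← hB]; rfl,
    show ∀ u, B u = A u from fun u => by rw [← hB]; rfl]
  conv_rhs => rw [← sum_smul_stdVec z]
  simp [apply_dualVec hA, mul_comm]

theorem sum_apply_dualVec_mul (hA : A.IsInvertible) {φ : Coord N → ℝ} (hφ : IsLinearMap ℝ φ)
    (w : Coord N) : ∑ i, A (dualVec A i) w * φ (stdVec i) = φ w := by
  conv_rhs => rw [← sum_smul_stdVec w, ← hφ.mk'_apply, map_sum]
  simp [apply_dualVec hA]

theorem sum_apply_stdVec_mul (hA : A.IsInvertible) {φ : Coord N → ℝ} (hφ : IsLinearMap ℝ φ)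
    (w : Coord N) : ∑ i, A w (stdVec i) * φ (dualVec A i) = φ w := by
  conv_rhs => rw [← sum_smul_dualVec hA w, ← hφ.mk'_apply, map_sum]
  simp

/-- Both sides are the contraction of `h` with the Gram matrix of the dual basis, which is
symmetric; `h` itself need not be. -/
theorem sum_stdVec_dualVec_comm (hA : A.IsInvertible) (hs : ∀ u v, A u v = A v u)
    {h : Coord N → Coord N → ℝ} (hh : IsTwoLinear h) :
    ∑ i, h (stdVec i) (dualVec A i) = ∑ i, h (dualVec A i) (stdVec i) := by
  have h1 : ∀ i, h (stdVec i) (dualVec A i) =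
      ∑ j, A (dualVec A j) (dualVec A i) * h (stdVec i) (stdVec j) := fun i =>
    (sum_apply_dualVec_mul hA (hh.snd (stdVec i)) (dualVec A i)).symm
  have h2 : ∀ j, h (dualVec A j) (stdVec j) =
      ∑ i, A (dualVec A i) (dualVec A j) * h (stdVec i) (stdVec j) := fun j =>
    (sum_apply_dualVec_mul hA (hh.fst (stdVec j)) (dualVec A j)).symm
  simp only [h1, h2]
  rw [Finset.sum_comm]
  exact Finset.sum_congr rfl fun j _ => Finset.sum_congr rfl fun i _ => by rw [hs]

theorem sum_apply_dualVec_stdVec (hA : A.IsInvertible) :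
    ∑ i, A (dualVec A i) (stdVec i) = N := by
  simp [apply_dualVec hA, stdVec]

theorem isTwoLinear_apply (A : Coord N →L[ℝ] Coord N →L[ℝ] ℝ) : IsTwoLinear fun u v => A u v :=
  ⟨fun v => ⟨by simp, by simp⟩, fun u => ⟨by simp, by simp⟩⟩

/-- The Ricci contraction of a Kulkarni-Nomizu product. -/
theorem sum_kulkarniNomizu (hA : A.IsInvertible) (hs : ∀ u v, A u v = A v u)
    {h : Coord N → Coord N → ℝ} (hh : IsTwoLinear h) (v w : Coord N) :
    ∑ i, kulkarniNomizu h (fun u v => A u v) (stdVec i) v (dualVec A i) w =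
      (∑ i, h (stdVec i) (dualVec A i)) * A v w + (N - 2) * h v w := by
  have h1 : ∑ i, A (stdVec i) (dualVec A i) = (N : ℝ) := by
    simp only [← sum_apply_dualVec_stdVec hA, hs]
  have h2 := sum_apply_dualVec_mul hA (hh.fst w) v
  have h3 := sum_apply_stdVec_mul hA (hh.snd v) w
  simp only [kulkarniNomizu, Finset.sum_add_distrib, Finset.sum_sub_distrib, ← Finset.sum_mul,
    ← Finset.mul_sum, h1]
  have h4 : ∑ i, h (stdVec i) w * A v (dualVec A i) = h v w := by
    rw [← h2]
    exact Finset.sum_congr rfl fun i _ => by rw [hs v, mul_comm]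
  have h5 : ∑ i, h v (dualVec A i) * A (stdVec i) w = h v w := by
    rw [← h3]
    exact Finset.sum_congr rfl fun i _ => by rw [hs w, mul_comm]
  rw [h4, h5]
  ring

variable {G G' : Coord N → Coord N →L[ℝ] Coord N →L[ℝ] ℝ} {F : Coord N → ℝ} {x : Coord N}

theorem isFourLinear_riemann (G : Coord N → Coord N →L[ℝ] Coord N →L[ℝ] ℝ) (x : Coord N) :
    IsFourLinear (riemann G x) := by
  constructor <;> intro p q r <;> constructor <;> intros <;>
    simp only [riemann, curvEndo, map_add, map_sub,
      map_smul, _root_.add_apply, _root_.sub_apply, _root_.smul_apply, smul_eq_mul] <;> ring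

theorem isTwoLinear_ricci (G : Coord N → Coord N →L[ℝ] Coord N →L[ℝ] ℝ) (x : Coord N) :
    IsTwoLinear (ricci G x) := by
  constructor <;> intro p <;> constructor <;> intros <;>
    simp only [ricci, curvEndo, map_add, map_smul, _root_.add_apply, _root_.smul_apply, PiLp.add_apply, PiLp.sub_apply, PiLp.smul_apply,
      Finset.sum_add_distrib, Finset.sum_sub_distrib, smul_eq_mul, ← Finset.mul_sum] <;> ring

theorem isTwoLinear_tracelessRicci (G : Coord N → Coord N →L[ℝ] Coord N →L[ℝ] ℝ) (x : Coord N) :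
    IsTwoLinear (tracelessRicci G x) := by
  have h := isTwoLinear_ricci G x
  constructor <;> intro p <;> constructor <;> intros <;>
    simp only [tracelessRicci, (h.fst _).map_add, (h.snd _).map_add, (h.fst _).map_smul,
      (h.snd _).map_smul, map_add, map_smul, _root_.add_apply, _root_.smul_apply, smul_eq_mul] <;>
    ring

theorem isTwoLinear_conformalHess (G : Coord N → Coord N →L[ℝ] Coord N →L[ℝ] ℝ) (F : Coord N → ℝ)
    (x : Coord N) : IsTwoLinear (conformalHess G F x) := by
  constructor <;> intro p <;> constructor <;> intros <;>
    simp only [conformalHess, map_add, map_smul, _root_.add_apply, _root_.smul_apply,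
      smul_eq_mul] <;>
    ring

/-- Pairing with `dualVec` extracts a coordinate, so the trace of an endomorphism becomes a metric
trace of the curvature tensor. -/
theorem IsMetricNear.ricci_eq_sum (h : IsMetricNear G x) (v w : Coord N) :
    ricci G x v w = ∑ i, riemann G x (stdVec i) v (dualVec (G x) i) w := by
  refine Finset.sum_congr rfl fun i _ => ?_
  rw [riemann, h.symm, apply_dualVec h.invertible]

theorem scalarCurv_eq_sum :
    scalarCurv G x = ∑ i, ricci G x (dualVec (G x) i) (stdVec i) := rfl

theorem dualVec_conformal (h : IsMetricNear G x) (hF : ContDiffAt ℝ 2 F x)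
    (hG' : ∀ y, G' y = Real.exp (2 * F y) • G y) (i : Fin N) :
    dualVec (G' x) i = (Real.exp (2 * F x))⁻¹ • dualVec (G x) i := by
  refine (h.conformal hF hG').ext_apply fun w => ?_
  rw [apply_dualVec (h.conformal hF hG').invertible, hG']
  simp [apply_dualVec h.invertible, (Real.exp_pos _).ne']

/-- The trace of `riemann_conformal`; the factor `e^{2F}` cancels against the one in the new dual
basis. -/
theorem IsMetricNear.ricci_conformal (h : IsMetricNear G x) (hF : ContDiffAt ℝ 2 F x)
    (hG' : ∀ y, G' y = Real.exp (2 * F y) • G y) (v w : Coord N) :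
    ricci G' x v w = ricci G x v w
      - ((∑ i, conformalHess G F x (stdVec i) (dualVec (G x) i)) * G x v w
        + (N - 2) * conformalHess G F x v w) := by
  rw [(h.conformal hF hG').ricci_eq_sum, h.ricci_eq_sum, ← sum_kulkarniNomizu h.invertible
    (h.symm x) (isTwoLinear_conformalHess G F x), ← Finset.sum_sub_distrib]
  refine Finset.sum_congr rfl fun i _ => ?_
  have hne := (Real.exp_pos (2 * F x)).ne'
  rw [dualVec_conformal h hF hG', ((isFourLinear_riemann G' x).thd _ _ _).map_smul,
    h.riemann_conformal hF hG', smul_eq_mul, ← mul_assoc, inv_mul_cancel₀ hne, one_mul]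

theorem IsMetricNear.scalarCurv_conformal (h : IsMetricNear G x) (hF : ContDiffAt ℝ 2 F x)
    (hG' : ∀ y, G' y = Real.exp (2 * F y) • G y) :
    scalarCurv G' x = (Real.exp (2 * F x))⁻¹ * (scalarCurv G x
      - 2 * (N - 1) * ∑ i, conformalHess G F x (stdVec i) (dualVec (G x) i)) := by
  have h1 := sum_stdVec_dualVec_comm h.invertible (h.symm x) (isTwoLinear_conformalHess G F x)
  have h2 : ∀ i, ricci G' x (dualVec (G' x) i) (stdVec i) = (Real.exp (2 * F x))⁻¹ *
      ricci G' x (dualVec (G x) i) (stdVec i) := fun i => by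
    rw [dualVec_conformal h hF hG', ((isTwoLinear_ricci G' x).fst _).map_smul, smul_eq_mul]
  rw [scalarCurv_eq_sum, scalarCurv_eq_sum]
  simp only [h2]
  rw [← Finset.mul_sum]
  congr 1
  simp only [h.ricci_conformal hF hG', Finset.sum_sub_distrib, Finset.sum_add_distrib,
    ← Finset.mul_sum, sum_apply_dualVec_stdVec h.invertible]
  rw [← h1]
  ring

/-- Conformal covariance of the Weyl tensor. -/
theorem IsMetricNear.weyl_conformal (hN : 2 < N) (h : IsMetricNear G x) (hF : ContDiffAt ℝ 2 F x)
    (hG' : ∀ y, G' y = Real.exp (2 * F y) • G y) (u v a b : Coord N) :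
    weyl G' x u v a b = Real.exp (2 * F x) * weyl G x u v a b := by
  have hN' : (2 : ℝ) < N := by exact_mod_cast hN
  have h0 : (N : ℝ) ≠ 0 := by linarith
  have h1 : (N : ℝ) - 1 ≠ 0 := by linarith
  have h2 : (N : ℝ) - 2 ≠ 0 := by linarith
  have hne := (Real.exp_pos (2 * F x)).ne'
  simp only [weyl, tracelessRicci, h.riemann_conformal hF hG', h.ricci_conformal hF hG',
    h.scalarCurv_conformal hF hG', hG', kulkarniNomizu, _root_.smul_apply, smul_eq_mul]
  -- A rational identity in `N` and `c` remains: the changes of traceless Ricci and scalar curvature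
  -- absorb the whole term `KN(conformalHess, G)`.
  generalize Real.exp (2 * F x) = c at *
  field_simp
  ring

/-- The Weyl tensor is trace-free. -/
theorem IsMetricNear.sum_weyl (hN : 2 < N) (h : IsMetricNear G x) (v w : Coord N) :
    ∑ i, weyl G x (stdVec i) v (dualVec (G x) i) w = 0 := by
  have hN' : (2 : ℝ) < N := by exact_mod_cast hN
  have h0 : (N : ℝ) ≠ 0 := by linarith
  have h1 : (N : ℝ) - 1 ≠ 0 := by linarith
  have h2 : (N : ℝ) - 2 ≠ 0 := by linarith
  have h3 : ∑ i, G x (stdVec i) (dualVec (G x) i) = (N : ℝ) := by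
    simp only [← sum_apply_dualVec_stdVec h.invertible, h.symm x (stdVec _)]
  have h4 : ∑ i, tracelessRicci G x (stdVec i) (dualVec (G x) i) = 0 := by
    rw [sum_stdVec_dualVec_comm h.invertible (h.symm x) (isTwoLinear_tracelessRicci G x)]
    simp only [tracelessRicci, Finset.sum_sub_distrib, ← Finset.mul_sum,
      sum_apply_dualVec_stdVec h.invertible, ← scalarCurv_eq_sum]
    field_simp
    ring
  simp only [weyl, Finset.sum_sub_distrib, ← Finset.mul_sum, ← h.ricci_eq_sum]
  rw [sum_kulkarniNomizu h.invertible (h.symm x) (isTwoLinear_tracelessRicci G x),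
    sum_kulkarniNomizu h.invertible (h.symm x) (isTwoLinear_apply (G x)), h4, h3, tracelessRicci]
  field_simp
  ring

end Trace

/-! ### Algebraic symmetries of the curvature and Weyl tensors -/

section Symmetries

variable {N : ℕ} {G : Coord N → Coord N →L[ℝ] Coord N →L[ℝ] ℝ} {x : Coord N}

theorem IsMetricNear.riemann_skew_right (h : IsMetricNear G x) (u v a b : Coord N) :
    riemann G x u v a b = -riemann G x u v b a := by
  have hl := isFourLinear_riemann G x
  have h1 := h.riemann_self_right u v (a + b)
  rw [(hl.thd _ _ _).map_add, (hl.fth _ _ _).map_add, (hl.fth _ _ _).map_add,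
    h.riemann_self_right, h.riemann_self_right] at h1
  linarith

/-- Since `Rm(u, v, a, b) = G(R(u, v) b, a)`, the cycled vectors are `u`, `v`, `b`, and `a` stays in
the third slot. -/
theorem IsMetricNear.riemann_bianchi (h : IsMetricNear G x) (u v a b : Coord N) :
    riemann G x u v a b + riemann G x v b a u + riemann G x b u a v = 0 := by
  simp only [riemann, ← _root_.add_apply, ← map_add, h.curvEndo_bianchi]
  simp

/-- The classical octahedron argument: four Bianchi identities, combined by means of the two
skew-symmetries. -/
theorem IsMetricNear.riemann_pair (h : IsMetricNear G x) (u v a b : Coord N) :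
    riemann G x u v a b = riemann G x a b u v := by
  have b1 := h.riemann_bianchi u v a b
  have b2 := h.riemann_bianchi v a b u
  have b3 := h.riemann_bianchi a b u v
  have b4 := h.riemann_bianchi b u v a
  have s1 := fun u v a b => riemann_skew_left (G := G) (x := x) u v a b
  have s2 := h.riemann_skew_right
  linarith [s1 u v a b, s1 v b a u, s1 b u a v, s1 v a b u, s1 a u b v, s1 u v b a, s1 a b u v,
    s1 b v u a, s1 v a u b, s1 b u v a, s1 u a v b, s1 a b v u,
    s2 u v a b, s2 v b a u, s2 b u a v, s2 v a b u, s2 a u b v, s2 a b u v, s2 u b a v]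

theorem IsMetricNear.ricci_symm (h : IsMetricNear G x) (v w : Coord N) :
    ricci G x v w = ricci G x w v := by
  have hl := isFourLinear_riemann G x
  rw [h.ricci_eq_sum, h.ricci_eq_sum, sum_stdVec_dualVec_comm h.invertible (h.symm x)
    (h := fun a b => riemann G x a v b w) ⟨fun _ => hl.fst _ _ _, fun _ => hl.thd _ _ _⟩]
  exact Finset.sum_congr rfl fun i _ => h.riemann_pair _ _ _ _

theorem weyl_skew_left (u v a b : Coord N) : weyl G x u v a b = -weyl G x v u a b := by
  rw [weyl, weyl, riemann_skew_left u v]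
  simp only [kulkarniNomizu]
  ring

theorem IsMetricNear.weyl_skew_right (h : IsMetricNear G x) (u v a b : Coord N) :
    weyl G x u v a b = -weyl G x u v b a := by
  rw [weyl, weyl, h.riemann_skew_right u v a b]
  simp only [kulkarniNomizu]
  ring

theorem IsMetricNear.weyl_pair (h : IsMetricNear G x) (u v a b : Coord N) :
    weyl G x u v a b = weyl G x a b u v := by
  have hs : ∀ v w, tracelessRicci G x v w = tracelessRicci G x w v := fun v w => by
    rw [tracelessRicci, tracelessRicci, h.ricci_symm, h.symm]
  rw [weyl, weyl, h.riemann_pair]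
  simp only [kulkarniNomizu, hs a, hs b, h.symm x a, h.symm x b]
  ring

end Symmetries

end HigherWeyl

namespace HigherWeyl

/-! ### From coordinates to the manifold -/

section Chart

variable {N : ℕ} {M : Type*} [TopologicalSpace M] [ChartedSpace (Coord N) M]
  [IsManifold 𝓘(ℝ, Coord N) ∞ M]

/-- The tangent space at `q` is by definition the model space read through the preferred chart at
`q`. -/
theorem chartDiff_apply (q : M) (u : Tan N q) : chartDiff q u = u := by
  have : IsManifold 𝓘(ℝ, Coord N) 1 M := IsManifold.of_le (n := ∞) (by simp)
  rw [chartDiff, mfderiv_extChartAt_self]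
  rfl

/-- Links `chartMetric`, defined by a pull-back, to the bundle coordinates in which the smoothness
of `g` is expressed. -/
theorem mfderiv_extChartAt_symm_eq (q : M) {y : Coord N}
    (hy : y ∈ (extChartAt 𝓘(ℝ, Coord N) q).target) :
    (mfderiv 𝓘(ℝ, Coord N) 𝓘(ℝ, Coord N) (extChartAt 𝓘(ℝ, Coord N) q).symm y :
        Coord N →L[ℝ] Coord N) =
      (trivializationAt (Coord N) (fun q : M => Tan N q) q).symmL ℝ
        ((extChartAt 𝓘(ℝ, Coord N) q).symm y) := by
  have : IsManifold 𝓘(ℝ, Coord N) 1 M := IsManifold.of_le (n := ∞) (by simp)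
  have h1 : (extChartAt 𝓘(ℝ, Coord N) q).symm y ∈ (chartAt (Coord N) q).source := by
    simpa using (extChartAt 𝓘(ℝ, Coord N) q).map_target hy
  have h2 := TangentBundle.symmL_trivializationAt (I := 𝓘(ℝ, Coord N)) h1
  rw [(extChartAt 𝓘(ℝ, Coord N) q).right_inv hy] at h2
  simp only [modelWithCornersSelf_coe, Set.range_id, mfderivWithin_univ] at h2
  exact h2.symm

theorem chartMetric_self (g : RiemMetric N M) (q : M) (u v : Coord N) :
    chartMetric g q (extChartAt 𝓘(ℝ, Coord N) q q) u v = metricAt g q u v := by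
  have : IsManifold 𝓘(ℝ, Coord N) 1 M := IsManifold.of_le (n := ∞) (by simp)
  have hd : ∀ w : Coord N, mfderiv 𝓘(ℝ, Coord N) 𝓘(ℝ, Coord N) (extChartAt 𝓘(ℝ, Coord N) q).symm
      (extChartAt 𝓘(ℝ, Coord N) q q) w = w := by
    intro w
    have h1 := TangentBundle.symmL_trivializationAt (I := 𝓘(ℝ, Coord N))
      (mem_chart_source (Coord N) q)
    simp only [modelWithCornersSelf_coe, Set.range_id, mfderivWithin_univ] at h1
    rw [TangentBundle.symmL_trivializationAt_eq_core (mem_chart_source (Coord N) q)] at h1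
    refine (DFunLike.congr_fun h1 w).symm.trans ?_
    exact (tangentBundleCore 𝓘(ℝ, Coord N) M).coordChange_self _ _ (mem_chart_source (Coord N) q) w
  -- The point `φ⁻¹(φ(q))` equals `q` only propositionally, so the fibre has to be transported.
  have hg : ∀ p : M, p = q → ∀ a b : Coord N,
      g.inner p (a : Tan N p) (b : Tan N p) = g.inner q (a : Tan N q) (b : Tan N q) := by
    rintro p rfl a b
    rfl
  refine (chartMetric_apply g q _ u v).trans ?_
  refine (congrArg₂ (fun a b : Coord N => g.inner ((extChartAt 𝓘(ℝ, Coord N) q).symm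
    (extChartAt 𝓘(ℝ, Coord N) q q)) a b) (hd u) (hd v)).trans ?_
  exact hg _ (extChartAt_to_inv q) u v

theorem contDiffAt_chartMetric (g : RiemMetric N M) (q : M) :
    ContDiffAt ℝ ∞ (chartMetric g q) (extChartAt 𝓘(ℝ, Coord N) q q) := by
  have h1 := g.contMDiff.contMDiffAt (x := q)
  rw [contMDiffAt_hom_bundle] at h1
  have h2 := h1.2
  have h3 : ContMDiffAt 𝓘(ℝ, Coord N) 𝓘(ℝ, Coord N) ∞ (extChartAt 𝓘(ℝ, Coord N) q).symm
      (extChartAt 𝓘(ℝ, Coord N) q q) :=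
    (contMDiffOn_extChartAt_symm q).contMDiffAt (extChartAt_target_mem_nhds q)
  have h4 := ContMDiffAt.comp (extChartAt 𝓘(ℝ, Coord N) q q)
    (by simpa using h2) h3
  refine (contMDiffAt_iff_contDiffAt.1 h4).congr_of_eventuallyEq ?_
  filter_upwards [extChartAt_target_mem_nhds (I := 𝓘(ℝ, Coord N)) q] with y hy
  have hs : (extChartAt 𝓘(ℝ, Coord N) q).symm y ∈
      (trivializationAt (Coord N) (fun q : M => Tan N q) q).baseSet := by
    simpa using (extChartAt 𝓘(ℝ, Coord N) q).map_target hy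
  ext a b
  rw [chartMetric_apply]
  simp only [Function.comp_apply]
  rw [inCoordinates_apply_eq₂ hs hs (Set.mem_univ _)]
  rw [mfderiv_extChartAt_symm_eq q hy]
  simp only [Bundle.Trivial.fiberBundle_trivializationAt',
    Bundle.Trivial.linearMapAt_trivialization, LinearMap.id_apply]
  exact congrArg₂ (fun v w : Tan N ((extChartAt 𝓘(ℝ, Coord N) q).symm y) => g.inner _ v w)
    (Bundle.Trivialization.symmL_apply _ hs a) (Bundle.Trivialization.symmL_apply _ hs b)

/-- Positivity gives injectivity, and equality of dimensions does the rest. -/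
theorem isInvertible_chartMetric_self (g : RiemMetric N M) (q : M) :
    (chartMetric g q (extChartAt 𝓘(ℝ, Coord N) q q)).IsInvertible := by
  set A := chartMetric g q (extChartAt 𝓘(ℝ, Coord N) q q) with hA
  let L : Coord N →ₗ[ℝ] (Coord N →L[ℝ] ℝ) := A
  have hinj : Function.Injective L := by
    refine (injective_iff_map_eq_zero L).2 fun u hu => ?_
    by_contra h0
    have h1 : A u u = metricAt g q u u := chartMetric_self g q u u
    have h2 : A u u = 0 := by
      rw [show A u = 0 from hu]; rfl
    exact ((isInner_metricAt g q).pos u h0).ne' (h1.symm.trans h2)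
  have hd : finrank ℝ (Coord N) = finrank ℝ (Coord N →L[ℝ] ℝ) := by
    rw [← LinearEquiv.finrank_eq (LinearMap.toContinuousLinearMap (𝕜 := ℝ) (E := Coord N)
      (F' := ℝ)), ← Subspace.dual_finrank_eq (K := ℝ) (V := Coord N)]
  refine ⟨(LinearEquiv.ofInjectiveOfFinrankEq L hinj hd).toContinuousLinearEquiv, ?_⟩
  ext u v
  rfl

theorem isMetricNear_chartMetric (g : RiemMetric N M) (q : M) :
    IsMetricNear (chartMetric g q) (extChartAt 𝓘(ℝ, Coord N) q q) where
  contDiffAt := (contDiffAt_chartMetric g q).of_le (by norm_cast)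
  symm y u v := g.symm _ _ _
  invertible := isInvertible_chartMetric_self g q

/-- Conformal covariance of the Weyl tensor of a Riemannian manifold. -/
theorem weylTensor_conformal (hN : 2 < N) {g g' : RiemMetric N M} {f : M → ℝ}
    (hf : ContMDiff 𝓘(ℝ, Coord N) 𝓘(ℝ, ℝ) ∞ f)
    (hg : ∀ (q : M) (u v : Tan N q), g'.inner q u v = Real.exp (2 * f q) * g.inner q u v)
    (q : M) (u v a b : Tan N q) :
    weylTensor g' q u v a b = Real.exp (2 * f q) * weylTensor g q u v a b := by
  have hF : ContDiffAt ℝ 2 (f ∘ (extChartAt 𝓘(ℝ, Coord N) q).symm)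
      (extChartAt 𝓘(ℝ, Coord N) q q) := by
    have h3 : ContMDiffAt 𝓘(ℝ, Coord N) 𝓘(ℝ, Coord N) ∞ (extChartAt 𝓘(ℝ, Coord N) q).symm
        (extChartAt 𝓘(ℝ, Coord N) q q) :=
      (contMDiffOn_extChartAt_symm q).contMDiffAt (extChartAt_target_mem_nhds q)
    exact (contMDiffAt_iff_contDiffAt.1 (hf.contMDiffAt.comp _ h3)).of_le
      (by norm_cast)
  have h := (isMetricNear_chartMetric g q).weyl_conformal hN hF (G' := chartMetric g' q)
    (fun y => by
      ext a b
      exact hg _ _ _) (chartDiff q u) (chartDiff q v) (chartDiff q a) (chartDiff q b)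
  rw [Function.comp_apply, extChartAt_to_inv] at h
  exact h

theorem weylTensor_skew_left (g : RiemMetric N M) (q : M) (u v a b : Tan N q) :
    weylTensor g q u v a b = -weylTensor g q v u a b :=
  weyl_skew_left _ _ _ _

theorem weylTensor_skew_right (g : RiemMetric N M) (q : M) (u v a b : Tan N q) :
    weylTensor g q u v a b = -weylTensor g q u v b a :=
  (isMetricNear_chartMetric g q).weyl_skew_right _ _ _ _

theorem weylTensor_pair (g : RiemMetric N M) (q : M) (u v a b : Tan N q) :
    weylTensor g q u v a b = weylTensor g q a b u v :=
  (isMetricNear_chartMetric g q).weyl_pair _ _ _ _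

/-- Carries the coordinate trace to an orthonormal frame: expand each `stdVec i` in the frame,
exchange the sums, and the sum over `i` turns `dualVec` back into `e j`. -/
theorem sum_weylTensor (hN : 2 < N) (g : RiemMetric N M) (q : M) {e : Basis (Fin N) ℝ (Tan N q)}
    (he : ∀ i j, metricAt g q (e i) (e j) = if i = j then 1 else 0) (v w : Tan N q) :
    ∑ i, weylTensor g q (e i) v (e i) w = 0 := by
  have hG := isMetricNear_chartMetric g q
  set A := chartMetric g q (extChartAt 𝓘(ℝ, Coord N) q q) with hA
  have hl := isFourLinear_weylTensor g q
  have hw : ∀ u v a b : Tan N q, weyl (chartMetric g q) (extChartAt 𝓘(ℝ, Coord N) q q) u v a b =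
      weylTensor g q u v a b := fun u v a b => by
    rw [weylTensor, chartDiff_apply, chartDiff_apply, chartDiff_apply, chartDiff_apply]
  have hexp : ∀ x : Tan N q, x = ∑ j, metricAt g q (e j) x • e j := by
    intro x
    conv_lhs => rw [← e.sum_repr x]
    refine Finset.sum_congr rfl fun j _ => ?_
    congr 1
    have h := congrArg (metricAt g q (e j)) (e.sum_repr x)
    simp only [map_sum, map_smul, he, smul_eq_mul, mul_ite, mul_one, mul_zero, Finset.sum_ite_eq,
      Finset.mem_univ, if_true] at h
    exact h
  have h1 : ∀ x y : Tan N q, weylTensor g q x v y w =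
      ∑ j, A (e j) x * weylTensor g q (e j) v y w := by
    intro x y
    conv_lhs => rw [hexp x, ← (hl.fst v y w).mk'_apply, map_sum]
    refine Finset.sum_congr rfl fun j _ => ?_
    rw [map_smul, smul_eq_mul, hA]
    exact congrArg (· * _) (chartMetric_self g q _ _).symm
  have h2 := hG.sum_weyl hN v w
  rw [← h2]
  have h3 : ∀ i, weyl (chartMetric g q) (extChartAt 𝓘(ℝ, Coord N) q q) (stdVec i) v
      (dualVec A i) w = ∑ j, A (e j) (stdVec i) * weylTensor g q (e j) v (dualVec A i) w :=
    fun i => (hw _ _ _ _).trans (h1 _ _)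
  rw [Finset.sum_congr rfl fun i _ => h3 i, Finset.sum_comm]
  refine Finset.sum_congr rfl fun j _ => ?_
  exact (sum_apply_stdVec_mul hG.invertible (hl.thd (e j) v w) (e j)).symm

end Chart
end HigherWeyl

namespace HigherWeyl

/-! ### Inner product and wedge product on exterior powers -/

section ExteriorInner

variable {V : Type*} [AddCommGroup V] [Module ℝ V]

theorem extInner_symm {B : LinearMap.BilinForm ℝ V} (hB : ∀ u v, B u v = B v u) (p : ℕ)
    (x y : ⋀[ℝ]^p V) : extInner B p x y = extInner B p y x := by
  have h : extInner B p = (extInner B p).flip := by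
    refine exteriorPower.linearMap_ext (AlternatingMap.ext fun u => ?_)
    refine exteriorPower.linearMap_ext (AlternatingMap.ext fun v => ?_)
    change extInner B p (exteriorPower.ιMulti ℝ p u) (exteriorPower.ιMulti ℝ p v) =
      extInner B p (exteriorPower.ιMulti ℝ p v) (exteriorPower.ιMulti ℝ p u)
    rw [extInner_ιMulti, extInner_ιMulti, ← Matrix.det_transpose]
    congr 1
    ext i j
    exact hB _ _
  exact LinearMap.congr_fun₂ h x y

theorem extInner_smul (c : ℝ) (B : LinearMap.BilinForm ℝ V) (p : ℕ) :
    extInner (c • B) p = c ^ p • extInner B p := by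
  refine exteriorPower.linearMap_ext (AlternatingMap.ext fun u => ?_)
  refine exteriorPower.linearMap_ext (AlternatingMap.ext fun v => ?_)
  change extInner (c • B) p (exteriorPower.ιMulti ℝ p u) (exteriorPower.ιMulti ℝ p v) =
    c ^ p * extInner B p (exteriorPower.ιMulti ℝ p u) (exteriorPower.ιMulti ℝ p v)
  rw [extInner_ιMulti, extInner_ιMulti]
  have := Matrix.det_smul (Matrix.of fun i j => B (u i) (v j)) c
  rw [Fintype.card_fin] at this
  rw [← this]
  rfl

theorem ext_extInner {N : ℕ} {B : LinearMap.BilinForm ℝ V} {e : Basis (Fin N) ℝ V}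
    (he : ∀ i j, B (e i) (e j) = if i = j then 1 else 0) {p : ℕ} {x y : ⋀[ℝ]^p V}
    (h : ∀ z, extInner B p z x = extInner B p z y) : x = y := by
  refine (e.exteriorPower p).repr.injective (Finsupp.ext fun J => ?_)
  rw [← extInner_basis he, ← extInner_basis he, h]

/-- Elements of even degree are central in the exterior algebra. -/
theorem exteriorPower_le_center (k : ℕ) :
    ⋀[ℝ]^(2 * k) V ≤ Subalgebra.toSubmodule (Subalgebra.center ℝ (ExteriorAlgebra ℝ V)) := by
  have h1 : ∀ a b : V, ExteriorAlgebra.ι ℝ a * ExteriorAlgebra.ι ℝ b ∈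
      Subalgebra.center ℝ (ExteriorAlgebra ℝ V) := by
    intro a b
    rw [Subalgebra.mem_center_iff]
    intro y
    induction y using ExteriorAlgebra.induction with
    | algebraMap r => exact Algebra.commutes _ _
    | ι c =>
      -- Moving `c` past two vectors changes the sign twice.
      have e1 := eq_neg_of_add_eq_zero_left (ExteriorAlgebra.ι_add_mul_swap (R := ℝ) c a)
      have e2 := eq_neg_of_add_eq_zero_left (ExteriorAlgebra.ι_add_mul_swap (R := ℝ) c b)
      rw [← mul_assoc, e1, neg_mul, mul_assoc, e2, mul_neg, neg_neg, mul_assoc]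
    | mul x y hx hy => rw [mul_assoc, hy, ← mul_assoc, hx, mul_assoc]
    | add x y hx hy => rw [add_mul, mul_add, hx, hy]
  have h2 : (LinearMap.range (ExteriorAlgebra.ι ℝ (M := V))) ^ 2 ≤
      Subalgebra.toSubmodule (Subalgebra.center ℝ (ExteriorAlgebra ℝ V)) := by
    rw [pow_two, Submodule.mul_le]
    rintro _ ⟨a, rfl⟩ _ ⟨b, rfl⟩
    exact h1 a b
  change (LinearMap.range (ExteriorAlgebra.ι ℝ (M := V))) ^ (2 * k) ≤ _
  rw [pow_mul]
  induction k with
  | zero =>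
    rw [pow_zero, Submodule.one_le]
    exact (Subalgebra.center ℝ (ExteriorAlgebra ℝ V)).one_mem
  | succ k ih =>
    rw [pow_succ, Submodule.mul_le]
    exact fun x hx y hy =>
      (Subalgebra.center ℝ (ExteriorAlgebra ℝ V)).mul_mem (ih hx) (h2 hy)

theorem mul_comm_of_even {p q : ℕ} (hp : Even p) (x : ⋀[ℝ]^p V) (y : ⋀[ℝ]^q V) :
    (x : ExteriorAlgebra ℝ V) * (y : ExteriorAlgebra ℝ V) =
      (y : ExteriorAlgebra ℝ V) * (x : ExteriorAlgebra ℝ V) := by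
  obtain ⟨k, rfl⟩ := hp
  have h := exteriorPower_le_center (V := V) k
  rw [two_mul] at h
  exact ((Subalgebra.mem_center_iff (R := ℝ)).1 (h x.2) y).symm

/-- The determinant form takes the value `1` on it. Used to cancel the volume element in the
defining equation of the star. -/
theorem ιMulti_basis_ne_zero {N : ℕ} (e : Basis (Fin N) ℝ V) :
    ExteriorAlgebra.ιMulti ℝ N e ≠ 0 := by
  intro h0
  have h1 : exteriorPower.ιMulti ℝ N e = 0 := Subtype.ext h0
  have h2 := exteriorPower.alternatingMapLinearEquiv_apply_ιMulti e.det e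
  rw [h1, map_zero, e.det_self] at h2
  exact zero_ne_one h2

end ExteriorInner

/-! ### The Hodge star in the middle dimension -/

section Star

variable {V : Type*} [AddCommGroup V] [Module ℝ V] {N p : ℕ}

theorem card_compl_eq (h : p + p = N) : p + p = Fintype.card (Fin N) := by simpa using h

/-- The complement of a set of half of the indices. -/
abbrev complHalf (h : p + p = N) :
    Set.powersetCard (Fin N) p ≃ Set.powersetCard (Fin N) p :=
  Set.powersetCard.compl (card_compl_eq h)

theorem disjoint_complHalf (h : p + p = N) (J : Set.powersetCard (Fin N) p) :
    Disjoint J.val (complHalf h J).val := disjoint_compl_right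

/-- The sign of the shuffle permutation attached to a set of half of the indices. -/
def shuffleSign (h : p + p = N) (J : Set.powersetCard (Fin N) p) : ℤˣ :=
  (Set.powersetCard.permOfDisjoint (disjoint_complHalf h J)).sign

theorem shuffleSign_mul_self (h : p + p = N) (J : Set.powersetCard (Fin N) p) :
    ((shuffleSign h J : ℤ) : ℝ) * ((shuffleSign h J : ℤ) : ℝ) = 1 := by
  rcases Int.units_eq_one_or (shuffleSign h J) with h | h <;> simp [h]

/-- If `I ≠ J` have the same cardinality, `I` meets the complement of `J` and the product has a
repeated factor. -/
theorem exteriorPower_mul_compl (h : p + p = N) (e : Basis (Fin N) ℝ V)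
    (I J : Set.powersetCard (Fin N) p) :
    (e.exteriorPower p I : ExteriorAlgebra ℝ V) * (e.exteriorPower p (complHalf h J) :
        ExteriorAlgebra ℝ V) =
      if I = J then ((shuffleSign h J : ℤ) : ℝ) • ExteriorAlgebra.ιMulti ℝ N e else 0 := by
  rw [← ExteriorAlgebra.basis_eq_coe_basis, ← ExteriorAlgebra.basis_eq_coe_basis]
  split_ifs with hIJ
  · subst hIJ
    rw [ExteriorAlgebra.basis_mul_of_disjoint e I _ (disjoint_complHalf h I),
      Int.cast_smul_eq_zsmul, ← Units.smul_def]
    congr 1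
    subst h
    rw [ExteriorAlgebra.basis_apply_powersetCard, ExteriorAlgebra.ιMulti_family]
    congr 1
    -- The full index set has one increasing enumeration only, the identity.
    have : ∀ f : Fin (p + p) ↪o Fin (p + p), ⇑e ∘ f = e := by
      intro f
      have : f = (OrderIso.refl _).toOrderEmbedding := by
        have hu : ∀ s : Set.powersetCard (Fin (p + p)) (p + p), s.val = Finset.univ :=
          fun s => Finset.eq_univ_of_card _ (by simp)
        apply Set.powersetCard.ofFinEmbEquiv.injective
        exact Subtype.ext ((hu _).trans (hu _).symm)
      subst this; rfl
    exact this _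
  · apply ExteriorAlgebra.basis_mul_of_not_disjoint
    intro hdis
    apply hIJ
    apply Set.powersetCard.eq_iff_subset.2
    have : Disjoint I.val (J.val)ᶜ := hdis
    simpa using Finset.subset_compl_iff_disjoint_right.2 this

variable {B : LinearMap.BilinForm ℝ V} {o : Orientation ℝ V (Fin N)} {e : Basis (Fin N) ℝ V}
  {S : ⋀[ℝ]^p V →ₗ[ℝ] ⋀[ℝ]^p V}

theorem IsHodgeStar.apply_basis (hS : IsHodgeStar B o S) (he : IsPosONB B o e) (h : p + p = N)
    (J : Set.powersetCard (Fin N) p) :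
    S (e.exteriorPower p J) =
      ((shuffleSign h J : ℤ) : ℝ) • e.exteriorPower p (complHalf h J) := by
  refine (e.exteriorPower p).repr.injective (Finsupp.ext fun K => ?_)
  -- Every index is a complement, and wedging with `e_I` isolates the coefficient of `S e_J` at
  -- `I^c`.
  obtain ⟨I, rfl⟩ := (complHalf h).surjective K
  have h1 := hS e he (e.exteriorPower p I) (e.exteriorPower p J)
  rw [extInner_basis he.1, Basis.repr_self, Finsupp.single_apply,
    ← (e.exteriorPower p).sum_repr (S _), Submodule.coe_sum, Finset.mul_sum,
    ← (complHalf h).sum_comp] at h1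
  simp only [Submodule.coe_smul, mul_smul_comm, exteriorPower_mul_compl, smul_ite, smul_zero,
    Finset.sum_ite_eq, Finset.mem_univ, if_true] at h1
  rw [smul_smul] at h1
  have h2 := smul_left_injective ℝ (ιMulti_basis_ne_zero e) h1
  rw [map_smul, Basis.repr_self, Finsupp.smul_single, Finsupp.single_apply, smul_eq_mul, mul_one]
  have h3 : ((e.exteriorPower p).repr (S (e.exteriorPower p J)) (complHalf h I)) =
      ((shuffleSign h I : ℤ) : ℝ) * if J = I then 1 else 0 := by
    rw [← h2, mul_comm, mul_assoc, shuffleSign_mul_self, mul_one]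
  rw [h3]
  by_cases hJI : J = I
  · subst hJI; simp
  · rw [if_neg hJI, if_neg (fun h' => hJI ((complHalf h).injective h')), mul_zero]

theorem complHalf_complHalf (h : p + p = N) (J : Set.powersetCard (Fin N) p) :
    complHalf h (complHalf h J) = J :=
  Subtype.ext (compl_compl J.val)

/-- Elements of even degree commute, so `e_J ∧ e_{J^c} = e_{J^c} ∧ e_J`; hence `J` and `J^c` have
the same shuffle sign and the two signs in `S S e_J` multiply to `1`. -/
theorem IsHodgeStar.involutive (hS : IsHodgeStar B o S) (he : IsPosONB B o e) (h : p + p = N)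
    (hp : Even p) : S ∘ₗ S = LinearMap.id := by
  refine (e.exteriorPower p).ext fun J => ?_
  have h1 : ((shuffleSign h (complHalf h J) : ℤ) : ℝ) = ((shuffleSign h J : ℤ) : ℝ) := by
    have h2 := exteriorPower_mul_compl h e J J
    have h3 := exteriorPower_mul_compl h e (complHalf h J) (complHalf h J)
    rw [complHalf_complHalf, mul_comm_of_even hp, h2, if_pos rfl, if_pos rfl] at h3
    exact (smul_left_injective ℝ (ιMulti_basis_ne_zero e) h3).symm
  rw [LinearMap.comp_apply, hS.apply_basis he h, map_smul, hS.apply_basis he h, h1, smul_smul,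
    shuffleSign_mul_self, complHalf_complHalf, one_smul, LinearMap.id_apply]

/-- Evaluate `Sx ∧ Sy = Sy ∧ Sx` in both orders by the defining equation. -/
theorem IsHodgeStar.apply_symm (hS : IsHodgeStar B o S) (he : IsPosONB B o e)
    (hB : ∀ u v, B u v = B v u) (hp : Even p) (x y : ⋀[ℝ]^p V) :
    extInner B p (S x) y = extInner B p x (S y) := by
  have h1 := hS e he (S x) y
  have h2 := hS e he (S y) x
  rw [mul_comm_of_even hp, h2] at h1
  rw [extInner_symm hB p x (S y)]
  exact (smul_left_injective ℝ (ιMulti_basis_ne_zero e) h1).symm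

/-- In the middle dimension, the Hodge star does not change if the metric is multiplied by a
positive number. -/
theorem IsHodgeStar.smul (hS : IsHodgeStar B o S) (h : p + p = N) {c : ℝ} (hc : 0 < c) :
    IsHodgeStar (c • B) o S := by
  intro e he ξ η
  have hr := Real.sqrt_pos.2 hc
  -- As `e` is orthonormal for `c • B`, the frame `√c e` is orthonormal for `B`, with the same
  -- orientation. Its volume element is `(√c)^{2p} = c^p` times that of `e`, and `c^p` is also the
  -- factor of the inner product.
  let e' := e.unitsSMul fun _ => Units.mk0 (Real.sqrt c) hr.ne'
  have he' : ∀ i, e' i = Real.sqrt c • e i := fun i => by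
    simp [e', Basis.unitsSMul_apply, Units.smul_def]
  have hpos : IsPosONB B o e' := by
    constructor
    · intro i j
      have h1 := he.1 i j
      simp only [LinearMap.smul_apply, smul_eq_mul] at h1
      rw [he', he', map_smul, map_smul, LinearMap.smul_apply, smul_eq_mul, smul_eq_mul, ← mul_assoc,
        Real.mul_self_sqrt hc.le, h1]
    · rw [← he.2, Basis.orientation_unitsSMul]
      refine Module.Ray.units_smul_of_pos _ ?_ _
      simp only [Units.val_inv_eq_inv_val, Units.coe_prod, Units.val_mk0]
      positivity
  have h2 : ExteriorAlgebra.ιMulti ℝ N e' = c ^ p • ExteriorAlgebra.ιMulti ℝ N e := by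
    rw [show ⇑e' = fun i => Real.sqrt c • e i from funext he',
      AlternatingMap.map_smul_univ (ExteriorAlgebra.ιMulti ℝ N) (fun _ => Real.sqrt c) e]
    simp only [Finset.prod_const, Finset.card_univ, Fintype.card_fin]
    congr 1
    rw [← h, ← two_mul, pow_mul, Real.sq_sqrt hc.le]
  rw [hS e' hpos, h2, extInner_smul, smul_smul, LinearMap.smul_apply, LinearMap.smul_apply,
    smul_eq_mul, mul_comm]

end Star

end HigherWeyl

namespace HigherWeyl

/-! ### Block matrices relative to the star -/

section Blocks

variable {Λ : Type*} [AddCommGroup Λ] [Module ℝ Λ] {ι : Type*} [Fintype ι] [DecidableEq ι]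
  {S W : Λ →ₗ[ℝ] Λ} {b : Basis (ι ⊕ ι) ℝ Λ}

/-- Left multiplication by the matrix of `S` exchanges the block rows, right multiplication the
block columns. -/
theorem comm_iff_blocks (hS : LinearMap.toMatrix b b S = Matrix.fromBlocks 0 1 1 0) :
    S ∘ₗ W = W ∘ₗ S ↔ ∃ A B, LinearMap.toMatrix b b W = Matrix.fromBlocks A B B A := by
  rw [← (LinearMap.toMatrix b b).injective.eq_iff, LinearMap.toMatrix_comp b b b,
    LinearMap.toMatrix_comp b b b, hS]
  generalize LinearMap.toMatrix b b W = X
  rw [← Matrix.fromBlocks_toBlocks X, Matrix.fromBlocks_multiply, Matrix.fromBlocks_multiply]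
  simp only [zero_mul, one_mul, mul_zero, mul_one, zero_add, add_zero, Matrix.fromBlocks_inj]
  constructor
  · rintro ⟨h1, h2, h3, h4⟩
    exact ⟨_, _, rfl, rfl, h1, h2⟩
  · rintro ⟨A, B, rfl, h2, h3, h4⟩
    exact ⟨h3.trans h2.symm, h4, h4.symm, h2.trans h3.symm⟩

/-- As `ε² = 1`, the compression of `[[A, B], [B, A]]` has diagonal blocks `½(A - εB)` and
off-diagonal blocks `½(B - εA)`. The right-hand side is free of the basis. -/
theorem proportional_iff_blocks (hS : LinearMap.toMatrix b b S = Matrix.fromBlocks 0 1 1 0)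
    {ε : ℝ} (hε : ε * ε = 1) :
    (∃ A B, LinearMap.toMatrix b b W = Matrix.fromBlocks A B B A ∧ B = ε • A) ↔
      S ∘ₗ W = W ∘ₗ S ∧
        ((1 / 2 : ℝ) • (LinearMap.id + (-ε) • S)) ∘ₗ W ∘ₗ
          ((1 / 2 : ℝ) • (LinearMap.id + (-ε) • S)) = 0 := by
  have key : ∀ A B : Matrix ι ι ℝ, LinearMap.toMatrix b b W = Matrix.fromBlocks A B B A →
      (((1 / 2 : ℝ) • (LinearMap.id + (-ε) • S)) ∘ₗ W ∘ₗ
          ((1 / 2 : ℝ) • (LinearMap.id + (-ε) • S)) = 0 ↔ B = ε • A) := by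
    intro A B hAB
    rw [← (LinearMap.toMatrix b b).map_eq_zero_iff, LinearMap.toMatrix_comp b b b,
      LinearMap.toMatrix_comp b b b, hAB, map_smul, map_add, map_smul, hS, LinearMap.toMatrix_id,
      ← Matrix.fromBlocks_one, Matrix.fromBlocks_smul, Matrix.fromBlocks_add,
      Matrix.fromBlocks_smul, Matrix.fromBlocks_multiply, Matrix.fromBlocks_multiply,
      ← Matrix.fromBlocks_zero, Matrix.fromBlocks_inj]
    simp only [smul_zero, zero_add, add_zero, Matrix.smul_mul, Matrix.mul_smul, one_mul, mul_one]
    constructor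
    · rintro ⟨h1, h2, -, -⟩
      ext i j
      have h := congrFun (congrFun h2 i) j
      simp at h
      have h' := congrFun (congrFun h1 i) j
      simp at h'
      rw [Matrix.smul_apply, smul_eq_mul]
      linear_combination 2 * h - (B i j) / 2 * hε
    · rintro rfl
      refine ⟨?_, ?_, ?_, ?_⟩ <;> ext i j <;> simp
      · linear_combination -(A i j) / 4 * hε
      · linear_combination ε * A i j / 4 * hε
      · linear_combination ε * A i j / 4 * hε
      · linear_combination -(A i j) / 4 * hε
  constructor
  · rintro ⟨A, B, h1, h2⟩
    exact ⟨(comm_iff_blocks hS).2 ⟨A, B, h1⟩, (key A B h1).2 h2⟩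
  · rintro ⟨h1, h2⟩
    obtain ⟨A, B, h⟩ := (comm_iff_blocks hS).1 h1
    exact ⟨A, B, h, (key A B h).1 h2⟩

end Blocks

/-! ### Construction of Hodge bases -/

section HodgeBasis

variable {n : ℕ}

theorem card_half_of_compl {α : Type*} [Fintype α] {P : α → Prop} [DecidablePred P] (C : α ≃ α)
    (hC : ∀ a, P (C a) ↔ ¬P a) : Fintype.card {a // P a} = Fintype.card α / 2 := by
  have h1 : Fintype.card {a // P a} = Fintype.card {a // ¬P a} :=
    Fintype.card_congr (C.subtypeEquiv fun a => by rw [hC, not_not])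
  have h2 := Fintype.card_subtype_compl P
  have h3 := Fintype.card_subtype_le P
  omega

/-- The middle-dimensional index sets, listed so that the second half consists of the complements
of the first half. -/
theorem exists_halfEquiv (hn : 0 < n) (h : 2 * n + 2 * n = 4 * n) :
    ∃ E : Fin (halfDim n) ⊕ Fin (halfDim n) ≃ Set.powersetCard (Fin (4 * n)) (2 * n),
      ∀ k, E (Sum.inr k) = complHalf h (E (Sum.inl k)) := by
  classical
  let z : Fin (4 * n) := ⟨0, by omega⟩
  -- Exactly one of `J` and its complement contains the index `0`, which selects a representative of
  -- each complementary pair.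
  let P : Set.powersetCard (Fin (4 * n)) (2 * n) → Prop := fun J => z ∈ J.val
  have hP : ∀ J, P (complHalf h J) ↔ ¬P J := fun J => Finset.mem_compl
  have hc : Fintype.card {J // P J} = halfDim n := by
    rw [card_half_of_compl (complHalf h) hP, halfDim, ← Nat.card_eq_fintype_card,
      Set.powersetCard.card, Nat.card_eq_fintype_card, Fintype.card_fin]
  let f : Fin (halfDim n) ≃ {J // P J} := (Fintype.equivFinOfCardEq hc).symm
  let φ : Fin (halfDim n) ⊕ Fin (halfDim n) → Set.powersetCard (Fin (4 * n)) (2 * n) :=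
    Sum.elim (fun k => (f k).1) (fun k => complHalf h (f k).1)
  have hφ : Function.Bijective φ := by
    constructor
    · rintro (k | k) (l | l) hkl
      · exact congrArg Sum.inl (f.injective (Subtype.ext hkl))
      · exact absurd (f k).2 (by
          rw [show (f k).1 = complHalf h (f l).1 from hkl, hP, not_not]; exact (f l).2)
      · exact absurd (f l).2 (by
          rw [show (f l).1 = complHalf h (f k).1 from hkl.symm, hP, not_not]; exact (f k).2)
      · exact congrArg Sum.inr (f.injective (Subtype.ext ((complHalf h).injective hkl)))
    · intro J
      by_cases hJ : P J
      · exact ⟨Sum.inl (f.symm ⟨J, hJ⟩), by simp [φ]⟩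
      · exact ⟨Sum.inr (f.symm ⟨complHalf h J, (hP J).2 hJ⟩), by
          simp [φ, complHalf_complHalf]⟩
  exact ⟨Equiv.ofBijective φ hφ, fun k => rfl⟩

/-- Swapping the first two factors absorbs a sign, so the signed vector is still literally a wedge
of frame vectors; this is why `p ≥ 2` is needed. -/
theorem exists_signed_family {V : Type*} [AddCommGroup V] [Module ℝ V] {N p : ℕ} (hp : 2 ≤ p)
    (e : Basis (Fin N) ℝ V) (J : Set.powersetCard (Fin N) p) (ε : ℤˣ) :
    ∃ s : Fin p → Fin N, ((ε : ℤ) : ℝ) • e.exteriorPower p J =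
      exteriorPower.ιMulti ℝ p fun i => e (s i) := by
  have h0 : e.exteriorPower p J =
      exteriorPower.ιMulti ℝ p (e ∘ Set.powersetCard.ofFinEmbEquiv.symm J) :=
    exteriorPower.basis_apply ℝ p e J
  rcases Int.units_eq_one_or ε with rfl | rfl
  · exact ⟨Set.powersetCard.ofFinEmbEquiv.symm J, by rw [h0]; simp; rfl⟩
  · let i : Fin p := ⟨0, by omega⟩
    let j : Fin p := ⟨1, by omega⟩
    have hij : i ≠ j := by simp [i, j]
    refine ⟨Set.powersetCard.ofFinEmbEquiv.symm J ∘ Equiv.swap i j, ?_⟩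
    have h1 := (exteriorPower.ιMulti ℝ p (M := V)).map_swap
      (e ∘ Set.powersetCard.ofFinEmbEquiv.symm J) hij
    rw [h0]
    simpa using! h1.symm

variable {M : Type*} [TopologicalSpace M] [ChartedSpace (Coord (4 * n)) M]
  [IsManifold 𝓘(ℝ, Coord (4 * n)) ∞ M]

/-- The first half consists of `e_J`, one for each complementary pair; the second half is its image
under the star, `± e_{J^c}`, with `δ` recording the sign. Since `** = 1`, the star exchanges the
halves. -/
theorem exists_hodgeBasis (hn : 0 < n) (o : ManifoldOrientation (4 * n) M)
    (g : RiemMetric (4 * n) M) (q : M) (e : Basis (Fin (4 * n)) ℝ (Tan (4 * n) q))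
    (he : IsPosONB (metricAt g q) (o.at_ q) e) :
    ∃ b : Basis (Fin (halfDim n) ⊕ Fin (halfDim n)) ℝ (Mid n q),
      ArisesFrom e b ∧ IsHodgeBasis hn o g q b := by
  have h : 2 * n + 2 * n = 4 * n := by omega
  obtain ⟨E, hE⟩ := exists_halfEquiv hn h
  have hS := hodgeStar_spec hn o g q
  let δ : Fin (halfDim n) ⊕ Fin (halfDim n) → ℤˣ :=
    Sum.elim (fun _ => 1) fun k => shuffleSign h (E (Sum.inl k))
  have hδ : ∀ k, ((δ k : ℤ) : ℝ) * ((δ k : ℤ) : ℝ) = 1 := fun k => by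
    rcases Int.units_eq_one_or (δ k) with h | h <;> simp [h]
  let b : Basis (Fin (halfDim n) ⊕ Fin (halfDim n)) ℝ (Mid n q) :=
    ((e.exteriorPower (2 * n)).reindex E.symm).unitsSMul fun k =>
      Units.mk0 ((δ k : ℤ) : ℝ) (left_ne_zero_of_mul_eq_one (hδ k))
  have hb : ∀ k, b k = ((δ k : ℤ) : ℝ) • e.exteriorPower (2 * n) (E k) := fun k => by
    simp [b, Basis.unitsSMul_apply, Units.smul_def]
  have hinr : ∀ k, hodgeStar hn o g q (b (Sum.inl k)) = b (Sum.inr k) := fun k => by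
    rw [hb, hb, map_smul, hS.apply_basis he h, hE]
    simp [δ]
  have hinl : ∀ k, hodgeStar hn o g q (b (Sum.inr k)) = b (Sum.inl k) := fun k => by
    rw [← hinr]
    exact LinearMap.congr_fun (hS.involutive he h (even_two_mul n)) _
  refine ⟨b, fun k => ?_, ⟨fun k l => ?_, ?_⟩⟩
  · obtain ⟨s, hs⟩ := exists_signed_family (by omega : 2 ≤ 2 * n) e (E k) (δ k)
    exact ⟨s, (hb k).trans hs⟩
  · rw [hb, hb, map_smul, map_smul, LinearMap.smul_apply, extInner_basis he.1, Basis.repr_self,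
      Finsupp.single_apply]
    by_cases hkl : k = l
    · subst hkl
      simpa using hδ k
    · rw [if_neg hkl, if_neg fun h' => hkl (E.injective h').symm]
      simp
  · ext k l
    rw [LinearMap.toMatrix_apply]
    rcases l with l | l
    · rw [hinr, Basis.repr_self]
      rcases k with k | k <;> simp [Finsupp.single_apply, Matrix.one_apply, eq_comm]
    · rw [hinl, Basis.repr_self]
      rcases k with k | k <;> simp [Finsupp.single_apply, Matrix.one_apply, eq_comm]

/-- Trades the existential over frames for a condition on operators; independence of the basis and
conformal invariance are both read off from the latter. -/
theorem blocksProportional_iff (hn : 0 < n) (o : ManifoldOrientation (4 * n) M)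
    (g : RiemMetric (4 * n) M) (q : M) {ε : ℝ} (hε : ε * ε = 1) :
    BlocksProportional ε hn o g q ↔ StarCommutes hn o g q ∧ weylPart (-ε) hn o g q = 0 := by
  constructor
  · rintro ⟨e, b, he, -, hb, hAB⟩
    exact (proportional_iff_blocks hb.star hε).1 hAB
  · intro h
    obtain ⟨e, he⟩ := exists_isPosONB (by omega : 0 < 4 * n) (finrank_tan q)
      (isInner_metricAt g q) (o.at_ q)
    obtain ⟨b, hb1, hb2⟩ := exists_hodgeBasis hn o g q e he
    exact ⟨e, b, he, hb1, hb2, (proportional_iff_blocks hb2.star hε).2 h⟩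

end HodgeBasis

/-! ### Conformal weights of the operators -/

section ConformalInvariance

variable {n : ℕ} {M : Type*} [TopologicalSpace M] [ChartedSpace (Coord (4 * n)) M]
  [IsManifold 𝓘(ℝ, Coord (4 * n)) ∞ M] {g g' : RiemMetric (4 * n) M}

theorem IsConformalTo.metricAt_eq {N : ℕ} {M : Type*} [TopologicalSpace M]
    [ChartedSpace (Coord N) M] [IsManifold 𝓘(ℝ, Coord N) ∞ M] {g g' : RiemMetric N M} {f : M → ℝ}
    (hg : ∀ (q : M) (u v : Tan N q), g'.inner q u v = Real.exp (2 * f q) * g.inner q u v) (q : M) :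
    metricAt g' q = Real.exp (2 * f q) • metricAt g q :=
  LinearMap.BilinForm.ext fun u v => hg q u v

theorem powTensor_smul {V : Type*} {W W' : V → V → V → V → ℝ} {c : ℝ}
    (hW : ∀ u v a b, W' u v a b = c * W u v a b) (k : ℕ) (u v : Fin (2 * k) → V) :
    powTensor W' k u v = c ^ k * powTensor W k u v := by
  simp only [powTensor, hW, Finset.prod_mul_distrib, Finset.prod_const, Finset.card_univ,
    Fintype.card_fin]
  rw [mul_left_comm]
  congr 1
  rw [Finset.mul_sum]
  refine Finset.sum_congr rfl fun σ _ => ?_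
  rw [Finset.mul_sum]
  refine Finset.sum_congr rfl fun τ _ => ?_
  ring

/-- The operators attached to `W` and `B`, and to `c W` and `c B`, are proportional. -/
theorem powOperator_smul {V : Type*} [AddCommGroup V] [Module ℝ V] {N k : ℕ}
    {B : LinearMap.BilinForm ℝ V} {e : Basis (Fin N) ℝ V}
    (he : ∀ i j, B (e i) (e j) = if i = j then 1 else 0) (hB : ∀ u v, B u v = B v u)
    {W W' : V → V → V → V → ℝ} {c : ℝ} (hc : c ≠ 0)
    (hW : ∀ u v a b, W' u v a b = c * W u v a b)
    {L L' : ⋀[ℝ]^(2 * k) V →ₗ[ℝ] ⋀[ℝ]^(2 * k) V}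
    (hL : ∀ u v : Fin (2 * k) → V, extInner B (2 * k) (L (exteriorPower.ιMulti ℝ (2 * k) u))
      (exteriorPower.ιMulti ℝ (2 * k) v) = powTensor W k u v)
    (hL' : ∀ u v : Fin (2 * k) → V,
      extInner (c • B) (2 * k) (L' (exteriorPower.ιMulti ℝ (2 * k) u))
        (exteriorPower.ιMulti ℝ (2 * k) v) = powTensor W' k u v) :
    L = c ^ k • L' := by
  refine exteriorPower.linearMap_ext (AlternatingMap.ext fun u => ext_extInner he fun z => ?_)
  rw [extInner_symm hB, extInner_symm hB _ z]
  revert z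
  refine LinearMap.congr_fun (exteriorPower.linearMap_ext (AlternatingMap.ext fun v => ?_))
  change extInner B (2 * k) (L (exteriorPower.ιMulti ℝ (2 * k) u))
      (exteriorPower.ιMulti ℝ (2 * k) v) =
    extInner B (2 * k) (c ^ k • L' (exteriorPower.ιMulti ℝ (2 * k) u))
      (exteriorPower.ιMulti ℝ (2 * k) v)
  have h := hL' u v
  -- The inner product has weight `2k`, the power tensor only weight `k`; one factor `c^k` cancels
  -- and the other is the asserted one.
  have hpow : c ^ (2 * k) = c ^ k * c ^ k := by rw [two_mul, pow_add]
  rw [powTensor_smul hW, extInner_smul, hpow] at h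
  rw [hL, map_smul, LinearMap.smul_apply, smul_eq_mul]
  rw [LinearMap.smul_apply, LinearMap.smul_apply, smul_eq_mul, mul_assoc] at h
  exact (mul_left_cancel₀ (pow_ne_zero k hc) h).symm

/-- The Hodge star in the middle dimension is conformally invariant. -/
theorem hodgeStar_conformal (hn : 0 < n) (o : ManifoldOrientation (4 * n) M)
    (h : IsConformalTo g g') (q : M) : hodgeStar hn o g' q = hodgeStar hn o g q := by
  obtain ⟨f, -, hg⟩ := h
  refine (existsUnique_isHodgeStar (p := 2 * n) (q := 2 * n) (by omega) (finrank_tan q) (by omega)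
    (isInner_metricAt g' q) (o.at_ q)).unique (hodgeStar_spec hn o g' q) ?_
  rw [IsConformalTo.metricAt_eq hg]
  exact (hodgeStar_spec hn o g q).smul (by omega) (Real.exp_pos _)

theorem weylOp_conformal (hn : 0 < n) (o : ManifoldOrientation (4 * n) M)
    (h : IsConformalTo g g') (q : M) :
    ∃ c : ℝ, c ≠ 0 ∧ weylOp hn g q = c • weylOp hn g' q := by
  obtain ⟨f, hf, hg⟩ := h
  have hne := (Real.exp_pos (2 * f q)).ne'
  obtain ⟨e, he, -⟩ := exists_isPosONB (by omega : 0 < 4 * n) (finrank_tan q)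
    (isInner_metricAt g q) (o.at_ q)
  have h' := weylOp_spec hn g' q
  rw [IsConformalTo.metricAt_eq hg] at h'
  exact ⟨Real.exp (2 * f q) ^ n, pow_ne_zero _ hne,
    powOperator_smul he (isInner_metricAt g q).symm hne
      (weylTensor_conformal (by omega) hf hg q) (weylOp_spec hn g q) h'⟩

theorem starCommutes_conformal (hn : 0 < n) (o : ManifoldOrientation (4 * n) M)
    (h : IsConformalTo g g') (q : M) : StarCommutes hn o g q ↔ StarCommutes hn o g' q := by
  obtain ⟨c, hc, hW⟩ := weylOp_conformal hn o h q
  rw [StarCommutes, StarCommutes, hW, hodgeStar_conformal hn o h, LinearMap.comp_smul,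
    LinearMap.smul_comp]
  exact (smul_right_injective _ hc).eq_iff

theorem weylPart_eq_zero_conformal (ε : ℝ) (hn : 0 < n) (o : ManifoldOrientation (4 * n) M)
    (h : IsConformalTo g g') (q : M) :
    weylPart ε hn o g q = 0 ↔ weylPart ε hn o g' q = 0 := by
  obtain ⟨c, hc, hW⟩ := weylOp_conformal hn o h q
  have h1 : weylPart ε hn o g q = c • weylPart ε hn o g' q := by
    have h2 : eigenProj ε hn o g' q = eigenProj ε hn o g q := by
      rw [eigenProj, eigenProj, hodgeStar_conformal hn o h]
    rw [weylPart, weylPart, h2, hW, LinearMap.smul_comp, LinearMap.comp_smul]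
  rw [h1, smul_eq_zero, or_iff_right hc]

end ConformalInvariance

end HigherWeyl

namespace HigherWeyl

/-! ### Dimension four -/

section DimensionFour

/-- The four signed terms coincide by skew-symmetry and cancel the normalization `2 · 2! = 4`. -/
theorem powTensor_one {V : Type*} {W : V → V → V → V → ℝ}
    (h1 : ∀ u v a b, W u v a b = -W v u a b) (h2 : ∀ u v a b, W u v a b = -W u v b a)
    (u v : Fin (2 * 1) → V) :
    powTensor W 1 u v = W (u (pairL 0)) (u (pairR 0)) (v (pairL 0)) (v (pairR 0)) := by
  have hu : (Finset.univ : Finset (Equiv.Perm (Fin (2 * 1)))) =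
      {1, Equiv.swap (pairL 0) (pairR 0)} := by decide
  have hne : (1 : Equiv.Perm (Fin (2 * 1))) ≠ Equiv.swap (pairL 0) (pairR 0) := by decide
  have hLR : (pairL 0 : Fin (2 * 1)) ≠ pairR 0 := by decide
  rw [powTensor, hu, Finset.sum_pair hne, Finset.sum_pair hne, Finset.sum_pair hne]
  simp only [Fin.prod_univ_one, Equiv.Perm.sign_one, Equiv.Perm.sign_swap hLR,
    Equiv.Perm.one_apply, Equiv.swap_apply_left, Equiv.swap_apply_right]
  rw [h1 (u (pairR 0)) (u (pairL 0)), h1 (u (pairR 0)) (u (pairL 0)),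
    h2 _ _ (v (pairR 0)) (v (pairL 0))]
  simp [Nat.factorial]
  ring

/-- Components of a trace-free algebraic curvature tensor in dimension four. -/
theorem curvature_comp_dim_four {t : Fin 4 → Fin 4 → Fin 4 → Fin 4 → ℝ}
    (h1 : ∀ i j k l, t i j k l = -t j i k l) (h2 : ∀ i j k l, t i j k l = -t i j l k)
    (h3 : ∀ i j k l, t i j k l = t k l i j) (h4 : ∀ k l, ∑ i, t i k i l = 0)
    (τ : Equiv.Perm (Fin 4)) (hτ : Equiv.Perm.sign τ = 1) :
    t 0 1 (τ 2) (τ 3) = t 2 3 (τ 0) (τ 1) := by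
  -- The twelve even permutations.
  have hτ' : (τ 0, τ 1, τ 2, τ 3) ∈ ({(0, 1, 2, 3), (1, 0, 3, 2), (2, 3, 0, 1), (3, 2, 1, 0),
      (0, 2, 3, 1), (2, 0, 1, 3), (3, 1, 0, 2), (1, 3, 2, 0),
      (0, 3, 1, 2), (3, 0, 2, 1), (1, 2, 0, 3), (2, 1, 3, 0)} :
        Finset (Fin 4 × Fin 4 × Fin 4 × Fin 4)) := by
    revert τ
    decide
  have d1 : ∀ i k l, t i i k l = 0 := fun i k l => by linarith [h1 i i k l]
  have d2 : ∀ i k l, t k l i i = 0 := fun i k l => by linarith [h2 k l i i]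
  have l10 := h1 1 0
  have l20 := h1 2 0
  have l30 := h1 3 0
  have l21 := h1 2 1
  have l31 := h1 3 1
  have l32 := h1 3 2
  have r10 := fun i j => h2 i j 1 0
  have r20 := fun i j => h2 i j 2 0
  have r30 := fun i j => h2 i j 3 0
  have r21 := fun i j => h2 i j 2 1
  have r31 := fun i j => h2 i j 3 1
  have r32 := fun i j => h2 i j 3 2
  -- The alternating sum `s00 + s11 - s22 - s33` gives `t 0 1 0 1 = t 2 3 2 3`; an off-diagonal
  -- trace has just two nonzero terms, which relates components sharing one index; the remaining
  -- cases are pair symmetry. The Bianchi identity is not needed.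
  have s00 := h4 0 0
  have s11 := h4 1 1
  have s22 := h4 2 2
  have s33 := h4 3 3
  have s01 := h4 0 1
  have s02 := h4 0 2
  have s03 := h4 0 3
  have s12 := h4 1 2
  have s13 := h4 1 3
  have p1 := h3 2 3 0 2
  have p2 := h3 2 3 0 3
  have p3 := h3 2 3 1 2
  have p4 := h3 2 3 1 3
  have p5 := h3 2 3 0 1
  simp only [Fin.sum_univ_four, d1, d2, l10, l20, l30, l21, l31, l32, r10, r20, r30, r21, r31,
    r32] at s00 s11 s22 s33 s01 s02 s03 s12 s13
  simp only [Finset.mem_insert, Finset.mem_singleton, Prod.mk.injEq] at hτ'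
  rcases hτ' with h | h | h | h | h | h | h | h | h | h | h | h <;>
  · obtain ⟨e0, e1, e2, e3⟩ := h
    rw [e0, e1, e2, e3]
    try simp only [r10, r20, r30, r21, r31, r32]
    linarith

variable {V : Type*} [AddCommGroup V] [Module ℝ V] {B : LinearMap.BilinForm ℝ V}
  {o : Orientation ℝ V (Fin 4)} {e : Basis (Fin 4) ℝ V} {S : ⋀[ℝ]^2 V →ₗ[ℝ] ⋀[ℝ]^2 V}

theorem IsPosONB.reindex {N : ℕ} {o : Orientation ℝ V (Fin N)} {e : Basis (Fin N) ℝ V}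
    (he : IsPosONB B o e) {σ : Equiv.Perm (Fin N)} (hσ : Equiv.Perm.sign σ = 1) :
    IsPosONB B o (e.reindex σ.symm) := by
  have h1 : ⇑(e.reindex σ.symm) = e ∘ σ := by
    ext i
    simp
  refine ⟨fun i j => ?_, ?_⟩
  · rw [h1]
    simp only [Function.comp_apply, he.1, σ.injective.eq_iff]
  · rw [← he.2]
    refine ((Basis.orientation_eq_iff_det_pos e _).2 ?_).symm
    rw [h1, AlternatingMap.map_perm, hσ, e.det_self]
    norm_num

/-- With `** = 1`, the defining equation reads `w ∧ e₂ ∧ e₃ = ⟨w, *(e₂ ∧ e₃)⟩ dV`. For `w = e_i ∧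
e_j` the left side vanishes unless `{i, j} = {0, 1}`, so `*(e₂ ∧ e₃) = e₀ ∧ e₁`; apply `*` once
more. -/
theorem IsHodgeStar.apply_dim_four (hS : IsHodgeStar B o S) (he : IsPosONB B o e)
    (hB : ∀ u v, B u v = B v u) :
    S (exteriorPower.ιMulti ℝ 2 ![e 0, e 1]) = exteriorPower.ιMulti ℝ 2 ![e 2, e 3] := by
  have hinv : ∀ x, S (S x) = x := fun x =>
    LinearMap.congr_fun (hS.involutive he (by norm_num) (by decide)) x
  have key : ∀ w : ⋀[ℝ]^2 V, extInner B 2 w (S (exteriorPower.ιMulti ℝ 2 ![e 2, e 3])) =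
      extInner B 2 w (exteriorPower.ιMulti ℝ 2 ![e 0, e 1]) := by
    have hw : ∀ w : ⋀[ℝ]^2 V, extInner B 2 w (S (exteriorPower.ιMulti ℝ 2 ![e 2, e 3])) •
        ExteriorAlgebra.ιMulti ℝ 4 e =
          (w : ExteriorAlgebra ℝ V) * ExteriorAlgebra.ιMulti ℝ 2 ![e 2, e 3] := fun w => by
      rw [← hS e he, hinv]
      rfl
    intro w
    rw [extInner_symm hB _ w, extInner_symm hB _ w]
    revert w
    refine LinearMap.congr_fun (exteriorPower.linearMap_ext
      (Basis.ext_alternating e fun r hr => ?_))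
    change extInner B 2 (S (exteriorPower.ιMulti ℝ 2 ![e 2, e 3]))
        (exteriorPower.ιMulti ℝ 2 fun i => e (r i)) =
      extInner B 2 (exteriorPower.ιMulti ℝ 2 ![e 0, e 1])
        (exteriorPower.ιMulti ℝ 2 fun i => e (r i))
    rw [extInner_symm hB _ _ (exteriorPower.ιMulti ℝ 2 fun i => e (r i)),
      extInner_symm hB _ _ (exteriorPower.ιMulti ℝ 2 fun i => e (r i))]
    refine smul_left_injective ℝ (ιMulti_basis_ne_zero e) ?_
    simp only
    have hmul : ((exteriorPower.ιMulti ℝ 2 fun i => e (r i) : ⋀[ℝ]^2 V) : ExteriorAlgebra ℝ V) *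
        ExteriorAlgebra.ιMulti ℝ 2 ![e 2, e 3] =
          ExteriorAlgebra.ιMulti ℝ 4 (e ∘ ![r 0, r 1, 2, 3]) := by
      simp [ExteriorAlgebra.ιMulti_apply, Matrix.vecTail, mul_assoc]
    have hr01 : r 0 ≠ r 1 := hr.ne (by decide)
    rw [hw, extInner_ιMulti, Matrix.det_fin_two, hmul]
    simp only [Matrix.of_apply, Matrix.cons_val_zero, Matrix.cons_val_one, he.1]
    clear hmul
    generalize r 0 = i at *
    generalize r 1 = j at *
    by_cases hij : i = 0 ∧ j = 1
    · obtain ⟨rfl, rfl⟩ := hij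
      have h : (![0, 1, 2, 3] : Fin 4 → Fin 4) = id := by decide
      simp [h]
    by_cases hji : i = 1 ∧ j = 0
    · obtain ⟨rfl, rfl⟩ := hji
      have h : (![1, 0, 2, 3] : Fin 4 → Fin 4) = Equiv.swap 0 1 := by decide
      rw [h, AlternatingMap.map_swap _ _ (by decide)]
      simp
    · have h : ¬Function.Injective ![i, j, 2, 3] ∧
          ¬(i = 0 ∧ j = 1) ∧ ¬(i = 1 ∧ j = 0) := by
        clear hw hr
        revert i j
        decide
      rw [AlternatingMap.map_eq_zero_of_not_injective _ _ fun h' => h.1 h'.of_comp]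
      fin_cases i <;> fin_cases j <;> simp_all
  rw [← hinv (exteriorPower.ιMulti ℝ 2 ![e 2, e 3])]
  congr 1
  exact (ext_extInner he.1 key).symm

/-- Because `*` is self-adjoint and maps `e_{σ0} ∧ e_{σ1}` to `e_{σ2} ∧ e_{σ3}` for even `σ`, the
matrix entries to compare are `T(σ0, σ1, τ2, τ3)` and `T(σ2, σ3, τ0, τ1)`. -/
theorem IsHodgeStar.comm_dim_four (hS : IsHodgeStar B o S) (he : IsPosONB B o e)
    (hB : ∀ u v, B u v = B v u) {T : V → V → V → V → ℝ}
    (h1 : ∀ u v a b, T u v a b = -T v u a b) (h2 : ∀ u v a b, T u v a b = -T u v b a)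
    (h3 : ∀ u v a b, T u v a b = T a b u v)
    (h4 : ∀ e : Basis (Fin 4) ℝ V, IsPosONB B o e → ∀ v w, ∑ i, T (e i) v (e i) w = 0)
    {L : ⋀[ℝ]^2 V →ₗ[ℝ] ⋀[ℝ]^2 V}
    (hL : ∀ u v : Fin 2 → V, extInner B 2 (L (exteriorPower.ιMulti ℝ 2 u))
      (exteriorPower.ιMulti ℝ 2 v) = T (u 0) (u 1) (v 0) (v 1)) :
    S ∘ₗ L = L ∘ₗ S := by
  -- The two remaining indices can be swapped to make the permutation even.
  have hex : ∀ i j : Fin 4, i ≠ j → ∃ σ : Equiv.Perm (Fin 4), Equiv.Perm.sign σ = 1 ∧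
      σ 0 = i ∧ σ 1 = j := by decide
  have hfun : ∀ (r : Fin 2 → Fin 4) (σ : Equiv.Perm (Fin 4)), σ 0 = r 0 → σ 1 = r 1 →
      (fun i => e (r i)) = ![e (σ 0), e (σ 1)] := by
    intro r σ h0 h1
    ext i
    fin_cases i <;> simp [h0, h1]
  have hSσ : ∀ σ : Equiv.Perm (Fin 4), Equiv.Perm.sign σ = 1 →
      S (exteriorPower.ιMulti ℝ 2 ![e (σ 0), e (σ 1)]) =
        exteriorPower.ιMulti ℝ 2 ![e (σ 2), e (σ 3)] := by
    intro σ hσ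
    simpa using hS.apply_dim_four (he.reindex hσ) hB
  refine exteriorPower.linearMap_ext (Basis.ext_alternating e fun r hr =>
    ext_extInner he.1 fun z => ?_)
  rw [extInner_symm hB, extInner_symm hB _ z]
  revert z
  refine LinearMap.congr_fun (exteriorPower.linearMap_ext
    (Basis.ext_alternating e fun s hs => ?_))
  change extInner B 2 (S (L (exteriorPower.ιMulti ℝ 2 fun i => e (r i))))
      (exteriorPower.ιMulti ℝ 2 fun i => e (s i)) =
    extInner B 2 (L (S (exteriorPower.ιMulti ℝ 2 fun i => e (r i))))
      (exteriorPower.ιMulti ℝ 2 fun i => e (s i))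
  obtain ⟨σ, hσ, hσ0, hσ1⟩ := hex (r 0) (r 1) (hr.ne (by decide))
  obtain ⟨τ, hτ, hτ0, hτ1⟩ := hex (s 0) (s 1) (hs.ne (by decide))
  rw [hfun r σ hσ0 hσ1, hfun s τ hτ0 hτ1, hS.apply_symm he hB (by decide), hSσ σ hσ, hSσ τ hτ,
    hL, hL]
  -- In the frame reindexed by `σ`, again oriented and orthonormal, only the relative permutation
  -- `σ⁻¹ τ` matters.
  have h := curvature_comp_dim_four
    (t := fun i j k l => T (e (σ i)) (e (σ j)) (e (σ k)) (e (σ l)))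
    (fun _ _ _ _ => h1 _ _ _ _) (fun _ _ _ _ => h2 _ _ _ _) (fun _ _ _ _ => h3 _ _ _ _)
    (fun k l => by simpa using h4 _ (he.reindex hσ) (e (σ k)) (e (σ l))) (σ⁻¹ * τ)
    (by simp [hσ, hτ])
  simpa using h

end DimensionFour

section DimensionFourManifold

variable {M : Type*} [TopologicalSpace M] [ChartedSpace (Coord (4 * 1)) M]
  [IsManifold 𝓘(ℝ, Coord (4 * 1)) ∞ M]

theorem weylOp_dim_four (g : RiemMetric (4 * 1) M) (q : M) (hn : 0 < 1)
    (u v : Fin (2 * 1) → Tan (4 * 1) q) :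
    extInner (metricAt g q) (2 * 1) (weylOp hn g q (exteriorPower.ιMulti ℝ (2 * 1) u))
        (exteriorPower.ιMulti ℝ (2 * 1) v) =
      weylTensor g q (u (pairL ⟨0, hn⟩)) (u (pairR ⟨0, hn⟩))
        (v (pairL ⟨0, hn⟩)) (v (pairR ⟨0, hn⟩)) := by
  rw [weylOp_spec, powTensor_one (weylTensor_skew_left g q) (weylTensor_skew_right g q)]
  rfl

theorem starCommutes_dim_four (o : ManifoldOrientation (4 * 1) M) (g : RiemMetric (4 * 1) M)
    (q : M) (hn : 0 < 1) : StarCommutes hn o g q := by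
  obtain ⟨e, he⟩ := exists_isPosONB (by omega : 0 < 4 * 1) (finrank_tan q)
    (isInner_metricAt g q) (o.at_ q)
  exact IsHodgeStar.comm_dim_four (hodgeStar_spec hn o g q) he (isInner_metricAt g q).symm
    (weylTensor_skew_left g q) (weylTensor_skew_right g q) (weylTensor_pair g q)
    (fun e he => sum_weylTensor (by omega) g q he.1) (weylOp_dim_four g q hn)

end DimensionFourManifold

end HigherWeyl

theorem theorem2p4 (n : ℕ) (hn : 0 < n) {M : Type*} [TopologicalSpace M]
    [ChartedSpace (Coord (4 * n)) M] [IsManifold 𝓘(ℝ, Coord (4 * n)) ∞ M]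
    (o : ManifoldOrientation (4 * n) M) (g : RiemMetric (4 * n) M) :
    -- the commuting condition is a conformal invariant
    (∀ g' : RiemMetric (4 * n) M, IsConformalTo g g' →
      ∀ q : M, StarCommutes hn o g q ↔ StarCommutes hn o g' q) ∧
    -- every oriented orthonormal frame gives a basis in which the star is `[[0, I], [I, 0]]`, and
    -- in every such basis the commuting condition is equivalent to the block form
    (∀ (q : M) (e : Basis (Fin (4 * n)) ℝ (Tan (4 * n) q)),
      IsPosONB (metricAt g q) (o.at_ q) e →
        ∃ b : Basis (Fin (halfDim n) ⊕ Fin (halfDim n)) ℝ (Mid n q),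
          ArisesFrom e b ∧ IsHodgeBasis hn o g q b) ∧
    (∀ (q : M) (b : Basis (Fin (halfDim n) ⊕ Fin (halfDim n)) ℝ (Mid n q)),
      IsHodgeBasis hn o g q b →
        (StarCommutes hn o g q ↔ ∃ A B, HasBlockForm hn g q b A B)) ∧
    -- the conditions `B = A` and `B = -A` do not depend on the basis, are conformal invariants, and
    -- say that the anti-self-dual, respectively self-dual, part vanishes
    (∀ ε : ℝ, ε = 1 ∨ ε = -1 → ∀ q : M,
      (BlocksProportional ε hn o g q ↔
        ∀ b : Basis (Fin (halfDim n) ⊕ Fin (halfDim n)) ℝ (Mid n q),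
          IsHodgeBasis hn o g q b → ∃ A B, HasBlockForm hn g q b A B ∧ B = ε • A) ∧
      (∀ g' : RiemMetric (4 * n) M, IsConformalTo g g' →
        (BlocksProportional ε hn o g q ↔ BlocksProportional ε hn o g' q)) ∧
      (BlocksProportional ε hn o g q ↔
        StarCommutes hn o g q ∧ weylPart (-ε) hn o g q = 0)) ∧
    -- in dimension four the operator is the usual Weyl curvature operator, the commuting condition
    -- always holds, and the two conditions are `W⁻ = 0` and `W⁺ = 0`
    (n = 1 → ∀ q : M,
      (∀ u v : Fin (2 * n) → Tan (4 * n) q,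
        extInner (metricAt g q) (2 * n) (weylOp hn g q (exteriorPower.ιMulti ℝ (2 * n) u))
            (exteriorPower.ιMulti ℝ (2 * n) v) =
          weylTensor g q (u (pairL ⟨0, hn⟩)) (u (pairR ⟨0, hn⟩))
            (v (pairL ⟨0, hn⟩)) (v (pairR ⟨0, hn⟩))) ∧
      StarCommutes hn o g q ∧
      (BlocksProportional 1 hn o g q ↔ weylPart (-1) hn o g q = 0) ∧
      (BlocksProportional (-1) hn o g q ↔ weylPart 1 hn o g q = 0)) := by

  have hsq : ∀ ε : ℝ, ε = 1 ∨ ε = -1 → ε * ε = 1 := by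
    rintro ε (rfl | rfl) <;> norm_num
  refine ⟨fun g' hg q => starCommutes_conformal hn o hg q,
    fun q e he => exists_hodgeBasis hn o g q e he, fun q b hb => comm_iff_blocks hb.star,
    fun ε hε q => ⟨?_, fun g' hg => ?_, blocksProportional_iff hn o g q (hsq ε hε)⟩, ?_⟩
  · rw [blocksProportional_iff hn o g q (hsq ε hε)]
    constructor
    · exact fun h b hb => (proportional_iff_blocks hb.star (hsq ε hε)).2 h
    -- A Hodge basis exists, so the universal condition is not vacuous.
    · intro h
      obtain ⟨e, he⟩ := exists_isPosONB (by omega : 0 < 4 * n) (finrank_tan q)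
        (isInner_metricAt g q) (o.at_ q)
      obtain ⟨b, -, hb⟩ := exists_hodgeBasis hn o g q e he
      exact (proportional_iff_blocks hb.star (hsq ε hε)).1 (h b hb)
  · rw [blocksProportional_iff hn o g q (hsq ε hε), blocksProportional_iff hn o g' q (hsq ε hε),
      starCommutes_conformal hn o hg, weylPart_eq_zero_conformal (-ε) hn o hg]
  · rintro rfl q
    have hc := starCommutes_dim_four o g q hn
    refine ⟨weylOp_dim_four g q hn, hc, ?_, ?_⟩
    · rw [blocksProportional_iff hn o g q (by norm_num)]
      exact and_iff_right hc
    · rw [blocksProportional_iff hn o g q (by norm_num), neg_neg]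
      exact and_iff_right hc
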